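/- For $n\ge 0$ and $p\in[0,1]$ let $G^\sigma(n,p)$ be the random oriented graph on $n$ vertices in which each pair of distinct vertices is joined by an edge with probability $p$ and each edge is oriented in either direction with probability $1/2$, all choices being independent. Its skew-adjacency matrix $S_n=[s_{uv}]$ is the real skew-symmetric matrix with $s_{uv}=1$ and $s_{vu}=-1$ if $u\to v$ is an arc, and $s_{uv}=0$ if $u,v$ are not joined. For a Hermitian matrix $A$ of order $n$ with eigenvalues $\lambda_1(A),\dots,\lambda_n(A)$ (with multiplicity), its empirical spectral distribution (ESD) is the distribution function $F^A_n(x)=\frac1n\,|\{i : \lambda_i(A)\le x\}|$. Theorem. Let $p=p(n)\in[0,1]$ with $p=\omega(1/n)$, that is, $p(n)/(1/n)\to\infty$ as $n\to\infty$. Let $G_n$, $n\ge 0$, be random oriented graphs on a common probability space such that $G_n$ is distributed as $G^\sigma(n,p(n))$ for every $n$ (nothing is assumed about their joint distribution). Let $S_n$ be the skew-adjacency matrix of $G_n$ and $M_n=\frac{1}{\sqrt{p(n)}}(-i)S_n$, a Hermitian matrix. Then, almost surely, the empirical spectral distribution of $n^{-1/2}M_n$ converges in distribution, as $n\to\infty$,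 to the standard semicircle distribution, i.e. the distribution with density $\rho_{sc}(x)=\frac{1}{2\pi}\sqrt{4-x^2}$ for $|x|\le 2$ and $\rho_{sc}(x)=0$ otherwise. -/

import Mathlib

open MeasureTheory ProbabilityTheory Filter Topology unitInterval

noncomputable section

/-- An oriented graph on the vertex set `V`: a set of arcs without loops, with at most one of the
two arcs `u → v`, `v → u` for every pair of vertices (loops are excluded by `asymm` with
`u = v`). -/
@[ext]
structure OrientedGraph (V : Type*) where
  Adj : V → V → Prop
  asymm : ∀ u v, Adj u v → ¬ Adj v u

namespace OrientedGraph

instance instMeasurableSpaceOrientedGraph (V : Type*) : MeasurableSpace (OrientedGraph V) := ⊤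

open Classical in
/-- The skew-adjacency matrix: `s_uv = 1` and `s_vu = -1` if `u → v` is an arc, and `s_uv = 0` if
`u` and `v` are not joined by an arc. -/
def skewAdjMatrix {V : Type*} (G : OrientedGraph V) : Matrix V V ℝ :=
  Matrix.of fun u v => if G.Adj u v then 1 else if G.Adj v u then -1 else 0

/-- The unordered pairs of distinct vertices of `Fin n`, each written increasingly. -/
abbrev VertexPair (n : ℕ) : Type := {e : Fin n × Fin n // e.1 < e.2}

/-- The oriented graph determined by two coins per pair `u < v`: the first one tells whether the
edge `uv` is present, the second one whether it is oriented as `u → v` or as `v → u`. -/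
def ofCoins {n : ℕ} (c : VertexPair n → Bool × Bool) : OrientedGraph (Fin n) where
  Adj u v :=
    (∃ h : u < v, c ⟨(u, v), h⟩ = (true, true)) ∨ (∃ h : v < u, c ⟨(v, u), h⟩ = (true, false))
  asymm := by
    rintro u v (⟨h, hc⟩ | ⟨h, hc⟩) (⟨h', hc'⟩ | ⟨h', hc'⟩)
    · exact lt_asymm h h'
    · simp [hc] at hc'
    · simp [hc] at hc'
    · exact lt_asymm h h'

/-- The probability `1/2`. -/
def fairCoin : I := ⟨1 / 2, by norm_num, by norm_num⟩

/-- The random oriented graph model `G^σ(n, p)`: each pair of vertices is joined by an edge with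
probability `p`, and each edge is oriented in either way with probability `1/2`, all choices being
independent. -/
def randomModel (n : ℕ) (p : I) : Measure (OrientedGraph (Fin n)) :=
  (Measure.pi fun _ : VertexPair n =>
    (bernoulliMeasure true false p).prod (bernoulliMeasure true false fairCoin)).map ofCoins

/-- The normalized Hermitian matrix `M = (-i) S / √p`, where `S` is the skew-adjacency matrix. -/
def normalizedMatrix {V : Type*} (p : I) (G : OrientedGraph V) : Matrix V V ℂ :=
  (1 / ((Real.sqrt p : ℝ) : ℂ)) • ((-Complex.I) • G.skewAdjMatrix.map (fun s : ℝ => (s : ℂ)))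

/-- The matrix `n^{-1/2} M`. -/
def scaledMatrix {n : ℕ} (p : I) (G : OrientedGraph (Fin n)) : Matrix (Fin n) (Fin n) ℂ :=
  (1 / ((Real.sqrt n : ℝ) : ℂ)) • normalizedMatrix p G

theorem scaledMatrix_isHermitian {n : ℕ} (p : I) (G : OrientedGraph (Fin n)) :
    (scaledMatrix p G).IsHermitian := by
  ext u v
  have h : G.skewAdjMatrix v u = -G.skewAdjMatrix u v := by
    have := G.asymm u v
    by_cases h1 : G.Adj u v <;> by_cases h2 : G.Adj v u <;> simp_all [skewAdjMatrix]
  simp [scaledMatrix, normalizedMatrix, h]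

end OrientedGraph

/-- The empirical spectral distribution of a Hermitian matrix of order `n`:
`F(x) = |{i : λ_i ≤ x}| / n`, the eigenvalues `λ_1, …, λ_n` being listed with multiplicity. -/
def empiricalSpectralDistribution {n : ℕ} {A : Matrix (Fin n) (Fin n) ℂ} (hA : A.IsHermitian)
    (x : ℝ) : ℝ :=
  (1 / (n : ℝ)) * ((Finset.univ.filter fun i => hA.eigenvalues i ≤ x).card : ℝ)

/-- The semicircle density, supported on `[-2, 2]`. -/
def semicircleDensity (x : ℝ) : ℝ :=
  if |x| ≤ 2 then 1 / (2 * Real.pi) * Real.sqrt (4 - x ^ 2) else 0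

/-- The distribution function of the standard semicircle distribution. -/
def semicircleDistribution (x : ℝ) : ℝ := ∫ t in Set.Iic x, semicircleDensity t

/-- Convergence in distribution of distribution functions on `ℝ`: pointwise convergence at every
continuity point of the limit. -/
def ConvergesInDistribution (F : ℕ → ℝ → ℝ) (F' : ℝ → ℝ) : Prop :=
  ∀ x, ContinuousAt F' x → Tendsto (fun n => F n x) atTop (𝓝 (F' x))

end

noncomputable section

/-! Put A = S/√(np), so that A = iH for the scaled Hermitian matrix H. The normalized trace f of the
real resolvent (y + A)⁻¹ with y > 0 is the integral of 1/(y + ix) against the empirical spectral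
measure: the Stieltjes transform on the imaginary axis, where everything is real. For the semicircle
law this integral is m = (√(4 + y²) - y)/2, the positive root of m² + ym = 1.

The mean of f nearly satisfies the same equation. The trace of (y + A)R = 1 expresses 1 - yf through
the sums A_uv R_vu. Expanding R in the single entry A_uv, whose mean is 0 and whose variance is 1/n,
turns each such term on average into a quadratic expression in R, and these add up to f² up to
O(1/n) (`abs_sum_edge_le`, `abs_selfConsistent_le`). The third-order error is of size 1/√(np), which
tends to 0 because p = ω(1/n). The quadratic equation is stable at its positive root, so the means
converge (`tendsto_meanResolvent`).

Fluctuations are controlled by exponential moments, integrating out one pair at a time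
(`productExpectation.exp_sub_le`). The bound uses the variance of an entry, not its maximum, so
deviations have probability at most 2 exp(-cn) with c independent of p. This is summable however
slowly np grows, and Borel–Cantelli needs only the law of each G_n
(`ae_tendsto_graphResolventMean`).

Finally, the functions 1/(y + ix) with y rational and nonzero span, with the constants, a
point-separating star algebra, and they also control tails. Convergence of countably many transforms
therefore gives weak convergence (`tendsto_of_tendsto_integral_resolventKernel`). -/

theorem prod_apply_update_mul {ι α : Type*} [Fintype ι] [DecidableEq ι] (w : α → ℝ) (c : ι → α) (e : ι) (x : α) :
    (∏ i, w (Function.update c e x i)) * w (c e) = (∏ i, w (c i)) * w x := by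
  rw [← Finset.mul_prod_erase _ _ (Finset.mem_univ e),
    ← Finset.mul_prod_erase Finset.univ (fun i => w (c i)) (Finset.mem_univ e)]
  have : ∏ i ∈ Finset.univ.erase e, w (Function.update c e x i)
      = ∏ i ∈ Finset.univ.erase e, w (c i) :=
    Finset.prod_congr rfl fun i hi => by rw [Function.update_of_ne (Finset.ne_of_mem_erase hi)]
  rw [this, Function.update_self]
  ring

/-! ### Finite product expectations and exponential moments -/

section ProductExpectation

variable {ι α : Type*} [Fintype ι] [DecidableEq ι] [Fintype α]

/-- The expectation of `F` when the coordinates are independent with common weights `w`. -/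
def productExpectation (w : α → ℝ) (F : (ι → α) → ℝ) : ℝ := ∑ c, (∏ e, w (c e)) * F c

namespace productExpectation

variable {w : α → ℝ}

theorem const (hw : ∑ x, w x = 1) (r : ℝ) :
    productExpectation (ι := ι) w (fun _ => r) = r := by
  unfold productExpectation
  rw [← Finset.sum_mul, ← Fintype.prod_sum]
  simp [hw]

theorem add (F F' : (ι → α) → ℝ) :
    productExpectation w (fun c => F c + F' c) = productExpectation w F + productExpectation w F' := by
  simp [productExpectation, mul_add, Finset.sum_add_distrib]

theorem sub (F F' : (ι → α) → ℝ) :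
    productExpectation w (fun c => F c - F' c) = productExpectation w F - productExpectation w F' := by
  simp [productExpectation, mul_sub, Finset.sum_sub_distrib]

theorem const_mul (r : ℝ) (F : (ι → α) → ℝ) :
    productExpectation w (fun c => r * F c) = r * productExpectation w F := by
  simp only [productExpectation, Finset.mul_sum]
  exact Finset.sum_congr rfl fun c _ => by ring

theorem sum {κ : Type*} (s : Finset κ) (F : κ → (ι → α) → ℝ) :
    productExpectation w (fun c => ∑ k ∈ s, F k c) = ∑ k ∈ s, productExpectation w (F k) := by
  simp only [productExpectation, Finset.mul_sum]
  exact Finset.sum_comm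

theorem mono (hw : ∀ x, 0 ≤ w x) {F F' : (ι → α) → ℝ} (h : ∀ c, F c ≤ F' c) :
    productExpectation w F ≤ productExpectation w F' :=
  Finset.sum_le_sum fun c _ =>
    mul_le_mul_of_nonneg_left (h c) (Finset.prod_nonneg fun _ _ => hw _)

theorem abs_le (hw : ∀ x, 0 ≤ w x) (hw1 : ∑ x, w x = 1) {F : (ι → α) → ℝ} {b : ℝ}
    (h : ∀ c, |F c| ≤ b) : |productExpectation w F| ≤ b := by
  rw [_root_.abs_le]
  constructor
  · rw [← const (ι := ι) hw1 (-b)]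
    exact mono hw fun c => (_root_.abs_le.1 (h c)).1
  · rw [← const (ι := ι) hw1 b]
    exact mono hw fun c => (_root_.abs_le.1 (h c)).2

/-- Resampling one coordinate does not change the expectation. -/
theorem resample (hw : ∑ x, w x = 1) (e : ι) (F : (ι → α) → ℝ) :
    productExpectation w (fun c => ∑ x, w x * F (Function.update c e x))
      = productExpectation w F := by
  have h1 : productExpectation w (fun c => ∑ x, w x * F (Function.update c e x))
      = ∑ q : (ι → α) × α, (∏ i, w (q.1 i)) * (w q.2 * F (Function.update q.1 e q.2)) := by
    rw [Fintype.sum_prod_type]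
    simp [productExpectation, Finset.mul_sum]
  have h2 : productExpectation w F
      = ∑ q : (ι → α) × α, (∏ i, w (q.1 i)) * (w q.2 * F q.1) := by
    rw [Fintype.sum_prod_type]
    refine Finset.sum_congr rfl fun c _ => ?_
    simp only []
    rw [← Finset.mul_sum, ← Finset.sum_mul, hw, one_mul]
  rw [h1, h2]
  -- Swapping the old and the new value at e is an involution, and it preserves the joint weight.
  -- The multiplicative form of `prod_apply_update_mul` avoids dividing by weights that may be zero.
  refine Finset.sum_nbij' (fun q => (Function.update q.1 e q.2, q.1 e))
    (fun q => (Function.update q.1 e q.2, q.1 e)) (by simp) (by simp) ?_ ?_ ?_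
  · rintro ⟨c, x⟩ -; simp
  · rintro ⟨c, x⟩ -; simp
  · rintro ⟨c, x⟩ -
    have := prod_apply_update_mul w c e x
    simp only
    linear_combination (-F (Function.update c e x)) * this

end productExpectation

/-- Bound on the exponential moment of a centred variable which is close to a constant. -/
theorem sum_mul_exp_sub_le {w g d : α → ℝ} (hw : ∀ x, 0 ≤ w x) (hw1 : ∑ x, w x = 1) (r : ℝ)
    (hg : ∀ x, |g x - r| ≤ d x) (hd : ∀ x, d x ≤ 1) :
    ∑ x, w x * Real.exp (g x - ∑ z, w z * g z) ≤ Real.exp (∑ x, w x * d x ^ 2) := by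
  set m := ∑ z, w z * g z with hm
  -- From exp z ≤ 1 + z + z² for |z| ≤ 1. The linear term m - r is kept because recentring from r to
  -- the mean m contributes the factor exp(r - m), which cancels it.
  have h1 : ∑ x, w x * Real.exp (g x - r) ≤ Real.exp ((m - r) + ∑ x, w x * d x ^ 2) := by
    have h2 : ∑ x, w x * Real.exp (g x - r) ≤ ∑ x, w x * (1 + (g x - r) + d x ^ 2) := by
      refine Finset.sum_le_sum fun x _ => mul_le_mul_of_nonneg_left ?_ (hw x)
      have h3 := Real.abs_exp_sub_one_sub_id_le ((hg x).trans (hd x))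
      have h4 : (g x - r) ^ 2 ≤ d x ^ 2 := sq_le_sq' (abs_le.1 (hg x)).1 (abs_le.1 (hg x)).2
      linarith [(abs_le.1 h3).2]
    have h5 : ∑ x, w x * (1 + (g x - r) + d x ^ 2) = ((m - r) + ∑ x, w x * d x ^ 2) + 1 := by
      simp only [mul_add, mul_sub, Finset.sum_add_distrib, Finset.sum_sub_distrib, ← Finset.sum_mul,
        hw1, ← hm]
      ring
    rw [h5] at h2
    exact h2.trans (Real.add_one_le_exp _)
  have h6 : ∑ x, w x * Real.exp (g x - m)
      = Real.exp (r - m) * ∑ x, w x * Real.exp (g x - r) := by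
    rw [Finset.mul_sum]
    refine Finset.sum_congr rfl fun x _ => ?_
    rw [show g x - m = (r - m) + (g x - r) by ring, Real.exp_add]
    ring
  rw [h6]
  calc _ ≤ Real.exp (r - m) * Real.exp ((m - r) + ∑ x, w x * d x ^ 2) := by gcongr
    _ = _ := by rw [← Real.exp_add]; congr 1; ring

/-- Martingale argument, by induction on a set of coordinates that determines F. Averaging over one
coordinate e gives a function g of the remaining ones with the same mean and the same increment
bounds, and costs one factor exp(∑ w d²). Only the weighted mean of d² enters, not its maximum. -/
theorem productExpectation.exp_sub_le_of_finset {w d : α → ℝ} (hw : ∀ x, 0 ≤ w x)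
    (hw1 : ∑ x, w x = 1) (x₀ : α) (hd : ∀ x, d x ≤ 1) (s : Finset ι) :
    ∀ F : (ι → α) → ℝ, (∀ c c', (∀ e ∈ s, c e = c' e) → F c = F c') →
      (∀ c e, |F c - F (Function.update c e x₀)| ≤ d (c e)) →
      productExpectation w (fun c => Real.exp (F c - productExpectation w F))
        ≤ Real.exp (s.card * ∑ x, w x * d x ^ 2) := by
  induction s using Finset.induction_on with
  | empty =>
    intro F hF _
    obtain hι | ⟨⟨c₀⟩⟩ := isEmpty_or_nonempty (ι → α)
    · simp [productExpectation]
    have h : F = fun _ => F c₀ := funext fun c => hF _ _ (by simp)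
    rw [h]
    simp [productExpectation.const hw1]
  | insert e s he ih =>
    intro F hF hFd
    set g : (ι → α) → ℝ := fun c => ∑ x, w x * F (Function.update c e x) with hg
    have hEg : productExpectation w g = productExpectation w F :=
      productExpectation.resample hw1 e F
    have hgs : ∀ c c', (∀ i ∈ s, c i = c' i) → g c = g c' := by
      intro c c' h
      refine Finset.sum_congr rfl fun x _ => ?_
      congr 1
      refine hF _ _ fun i hi => ?_
      by_cases hie : i = e
      · subst hie; simp
      · rw [Function.update_of_ne hie, Function.update_of_ne hie]
        exact h i (Finset.mem_of_mem_insert_of_ne hi hie)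
    have hd0 : ∀ (c : ι → α) (i : ι), 0 ≤ d (c i) := fun c i => (abs_nonneg _).trans (hFd c i)
    have hgd : ∀ (c : ι → α) (i : ι), |g c - g (Function.update c i x₀)| ≤ d (c i) := by
      intro c i
      by_cases hi : i = e
      · subst hi
        have : g (Function.update c i x₀) = g c :=
          hgs _ _ fun j hj => Function.update_of_ne (ne_of_mem_of_not_mem hj he) _ _
        rw [this, sub_self, abs_zero]
        exact hd0 c i
      · have h1 : g c - g (Function.update c i x₀) = ∑ x, w x * (F (Function.update c e x)
            - F (Function.update (Function.update c e x) i x₀)) := by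
          simp only [hg, mul_sub, Finset.sum_sub_distrib]
          congr 1
          refine Finset.sum_congr rfl fun x _ => ?_
          rw [Function.update_comm hi]
        rw [h1]
        calc _ ≤ ∑ x, |w x * (F (Function.update c e x)
            - F (Function.update (Function.update c e x) i x₀))| := Finset.abs_sum_le_sum_abs _ _
          _ ≤ ∑ x, w x * d (c i) := by
            refine Finset.sum_le_sum fun x _ => ?_
            rw [abs_mul, abs_of_nonneg (hw x)]
            refine mul_le_mul_of_nonneg_left ?_ (hw x)
            have := hFd (Function.update c e x) i
            rwa [Function.update_of_ne hi] at this
          _ = d (c i) := by rw [← Finset.sum_mul, hw1, one_mul]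
    have hih := ih g hgs hgd
    rw [hEg] at hih
    -- With the other coordinates fixed, g c is the mean of F over coordinate e, so the one-variable
    -- bound applies to F - g.
    rw [← productExpectation.resample hw1 e]
    calc _ ≤ productExpectation w (fun c => Real.exp (∑ x, w x * d x ^ 2) *
          Real.exp (g c - productExpectation w F)) := by
          refine productExpectation.mono hw fun c => ?_
          have h1 := sum_mul_exp_sub_le (g := fun x => F (Function.update c e x)) hw hw1
            (F (Function.update c e x₀)) (d := d) (fun x => by
              have := hFd (Function.update c e x) e
              simpa using this) hd
          calc _ = (∑ x, w x * Real.exp (F (Function.update c e x) - g c)) *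
                Real.exp (g c - productExpectation w F) := by
                rw [Finset.sum_mul]
                refine Finset.sum_congr rfl fun x _ => ?_
                rw [mul_assoc, ← Real.exp_add]
                congr 2
                ring
            _ ≤ _ := by gcongr
      _ ≤ Real.exp (∑ x, w x * d x ^ 2) * Real.exp (s.card * ∑ x, w x * d x ^ 2) := by
          rw [productExpectation.const_mul]
          gcongr
      _ = _ := by
          rw [← Real.exp_add, Finset.card_insert_of_notMem he]
          congr 1
          push_cast
          ring

/-- Exponential moment bound for functions of independent variables: `F` changes by at most `d x`
when a coordinate with value `x` is reset to `x₀`. -/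
theorem productExpectation.exp_sub_le {w d : α → ℝ} (hw : ∀ x, 0 ≤ w x)
    (hw1 : ∑ x, w x = 1) (x₀ : α) (hd : ∀ x, d x ≤ 1) (F : (ι → α) → ℝ)
    (hF : ∀ c e, |F c - F (Function.update c e x₀)| ≤ d (c e)) :
    productExpectation w (fun c => Real.exp (F c - productExpectation w F))
      ≤ Real.exp (Fintype.card ι * ∑ x, w x * d x ^ 2) :=
  productExpectation.exp_sub_le_of_finset hw hw1 x₀ hd Finset.univ F
    (fun c c' h => by rw [funext fun e => h e (Finset.mem_univ e)]) hF

end ProductExpectation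

/-! ### Resolvents of real skew-symmetric matrices -/

section SkewResolvent

variable {V : Type*} [Fintype V] [DecidableEq V]

/-- The resolvent `(y + A)⁻¹`, used for real skew-symmetric `A` and `y > 0`. -/
def skewResolvent (y : ℝ) (A : Matrix V V ℝ) : Matrix V V ℝ := (y • (1 : Matrix V V ℝ) + A)⁻¹

/-- The skew-symmetric matrix with entry `1` at `(u, v)` and `-1` at `(v, u)`. -/
def skewSingle (u v : V) : Matrix V V ℝ := Matrix.single u v 1 - Matrix.single v u 1

theorem skewSingle_transpose {V : Type*} [DecidableEq V] (u v : V) : (skewSingle u v).transpose = -skewSingle u v := by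
  simp [skewSingle]

variable {y : ℝ} {A : Matrix V V ℝ}

/-- The quadratic form of a skew-symmetric matrix vanishes, so v · (y + A)v = y|v|² and the kernel
is trivial. -/
theorem isUnit_det_smul_one_add (hy : 0 < y) (hA : A.transpose = -A) :
    IsUnit (y • (1 : Matrix V V ℝ) + A).det := by
  rw [isUnit_iff_ne_zero]
  intro h
  obtain ⟨v, hv, h0⟩ := Matrix.exists_mulVec_eq_zero_iff.2 h
  have h1 : v ⬝ᵥ A.mulVec v = 0 := by
    have h2 : v ⬝ᵥ A.mulVec v = -(v ⬝ᵥ A.mulVec v) := by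
      conv_lhs => rw [Matrix.dotProduct_mulVec, ← Matrix.mulVec_transpose, hA, Matrix.neg_mulVec,
        neg_dotProduct, dotProduct_comm]
    linarith
  have h3 : v ⬝ᵥ (y • (1 : Matrix V V ℝ) + A).mulVec v = y * (v ⬝ᵥ v) := by
    rw [Matrix.add_mulVec, dotProduct_add, h1, Matrix.smul_mulVec, Matrix.one_mulVec,
      dotProduct_smul, add_zero, smul_eq_mul]
  rw [h0, dotProduct_zero] at h3
  rcases mul_eq_zero.1 h3.symm with h4 | h4
  · exact hy.ne' h4
  · exact hv (dotProduct_self_eq_zero.1 h4)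

theorem mul_skewResolvent (hy : 0 < y) (hA : A.transpose = -A) :
    (y • (1 : Matrix V V ℝ) + A) * skewResolvent y A = 1 :=
  Matrix.mul_nonsing_inv _ (isUnit_det_smul_one_add hy hA)

theorem skewResolvent_mul (hy : 0 < y) (hA : A.transpose = -A) :
    skewResolvent y A * (y • (1 : Matrix V V ℝ) + A) = 1 :=
  Matrix.nonsing_inv_mul _ (isUnit_det_smul_one_add hy hA)

theorem skewResolvent_transpose (hA : A.transpose = -A) :
    (skewResolvent y A).transpose = skewResolvent y (-A) := by
  rw [skewResolvent, Matrix.transpose_nonsing_inv, Matrix.transpose_add, Matrix.transpose_smul,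
    Matrix.transpose_one, hA, skewResolvent]

/-- Ward identity. Since Rᵀ is the inverse of y - A and (y + A) + (y - A) = 2y, one has 2y RᵀR = R +
Rᵀ; this is its diagonal entry. All size bounds on R come from here. -/
theorem sum_sq_skewResolvent_col (hy : 0 < y) (hA : A.transpose = -A) (v : V) :
    y * ∑ u, skewResolvent y A u v ^ 2 = skewResolvent y A v v := by
  set R := skewResolvent y A with hR
  have h1 : R.transpose * ((y • (1 : Matrix V V ℝ) + A) * R) = R.transpose := by
    rw [mul_skewResolvent hy hA, mul_one]
  have h2 : (R.transpose * (y • (1 : Matrix V V ℝ) - A)) * R = R := by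
    have h3 : R.transpose * (y • (1 : Matrix V V ℝ) - A) = 1 := by
      rw [hR, skewResolvent_transpose hA, sub_eq_add_neg]
      exact skewResolvent_mul hy (by rw [Matrix.transpose_neg, hA])
    rw [h3, one_mul]
  have h4 : (2 * y) • (R.transpose * R) = R.transpose + R := by
    conv_rhs => rw [← h1]; enter [2]; rw [← h2]
    simp only [mul_add, add_mul, mul_sub, sub_mul, mul_assoc, Matrix.smul_mul, Matrix.mul_smul,
      one_mul, mul_one, two_mul, add_smul]
    abel
  have h5 := congrFun (congrFun h4 v) v
  simp only [Matrix.smul_apply, Matrix.mul_apply, Matrix.add_apply, Matrix.transpose_apply,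
    smul_eq_mul] at h5
  simp only [pow_two]
  linarith

theorem sum_sq_skewResolvent_row (hy : 0 < y) (hA : A.transpose = -A) (v : V) :
    y * ∑ u, skewResolvent y A v u ^ 2 = skewResolvent y A v v := by
  have h := sum_sq_skewResolvent_col hy (A := -A) (by rw [Matrix.transpose_neg, hA]) v
  rw [← skewResolvent_transpose hA] at h
  exact h

theorem skewResolvent_diag_nonneg (hy : 0 < y) (hA : A.transpose = -A) (v : V) :
    0 ≤ skewResolvent y A v v := by
  rw [← sum_sq_skewResolvent_col hy hA v]
  positivity

/-- For a diagonal entry r, the Ward identity gives y r² ≤ r. -/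
theorem skewResolvent_diag_le (hy : 0 < y) (hA : A.transpose = -A) (v : V) :
    skewResolvent y A v v ≤ y⁻¹ := by
  have h1 := sum_sq_skewResolvent_col hy hA v
  have h2 : skewResolvent y A v v ^ 2 ≤ ∑ u, skewResolvent y A u v ^ 2 :=
    Finset.single_le_sum (f := fun u => skewResolvent y A u v ^ 2) (fun u _ => sq_nonneg _)
      (Finset.mem_univ v)
  have h3 := skewResolvent_diag_nonneg hy hA v
  by_contra! h4
  have h5 : 1 < y * skewResolvent y A v v := by
    have := mul_lt_mul_of_pos_left h4 hy
    rwa [mul_inv_cancel₀ hy.ne'] at this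
  have h6 : 0 < skewResolvent y A v v := (inv_pos.2 hy).trans h4
  nlinarith

theorem sum_sq_skewResolvent_col_le (hy : 0 < y) (hA : A.transpose = -A) (v : V) :
    ∑ u, skewResolvent y A u v ^ 2 ≤ (y⁻¹) ^ 2 := by
  have h1 := sum_sq_skewResolvent_col hy hA v
  have h2 := skewResolvent_diag_le hy hA v
  rw [← h1] at h2
  calc _ = y⁻¹ * (y * ∑ u, skewResolvent y A u v ^ 2) := by field_simp
    _ ≤ y⁻¹ * y⁻¹ := by gcongr
    _ = _ := by ring

theorem sum_sq_skewResolvent_row_le (hy : 0 < y) (hA : A.transpose = -A) (v : V) :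
    ∑ u, skewResolvent y A v u ^ 2 ≤ (y⁻¹) ^ 2 := by
  have h := sum_sq_skewResolvent_col_le hy (A := -A) (by rw [Matrix.transpose_neg, hA]) v
  rw [← skewResolvent_transpose hA] at h
  exact h

theorem abs_skewResolvent_le (hy : 0 < y) (hA : A.transpose = -A) (u v : V) :
    |skewResolvent y A u v| ≤ y⁻¹ := by
  refine abs_le_of_sq_le_sq ?_ (inv_pos.2 hy).le
  exact (Finset.single_le_sum (f := fun u => skewResolvent y A u v ^ 2) (fun u _ => sq_nonneg _)
      (Finset.mem_univ u)).trans (sum_sq_skewResolvent_col_le hy hA v)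

theorem skewResolvent_trace_eq (hy : 0 < y) (hA : A.transpose = -A) :
    y * (skewResolvent y A).trace + ∑ u, ∑ v, A u v * skewResolvent y A v u
      = Fintype.card V := by
  have h := congrArg Matrix.trace (mul_skewResolvent hy hA)
  rw [add_mul, Matrix.smul_mul, one_mul, Matrix.trace_add, Matrix.trace_smul, Matrix.trace_one,
    smul_eq_mul] at h
  rw [← h]
  simp [Matrix.trace, Matrix.mul_apply]

theorem skewResolvent_sub (hy : 0 < y) {B : Matrix V V ℝ} (hA : A.transpose = -A)
    (hB : B.transpose = -B) :
    skewResolvent y B - skewResolvent y A = skewResolvent y A * (A - B) * skewResolvent y B := by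
  have h : A - B = (y • (1 : Matrix V V ℝ) + A) - (y • (1 : Matrix V V ℝ) + B) := by abel
  rw [h, mul_sub, sub_mul, skewResolvent_mul hy hA, mul_assoc, mul_skewResolvent hy hB, one_mul,
    mul_one]

theorem transpose_add_smul_skewSingle {V : Type*} [DecidableEq V] {A : Matrix V V ℝ}
    (hA : A.transpose = -A) (t : ℝ) (u v : V) :
    (A + t • skewSingle u v).transpose = -(A + t • skewSingle u v) := by
  rw [Matrix.transpose_add, Matrix.transpose_smul, hA, skewSingle_transpose, neg_add, smul_neg]

/-- Resolvent identity for a rank-two perturbation: the two nonzero entries of `skewSingle u v`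
leave two products. -/
theorem skewResolvent_add_smul_skewSingle (hy : 0 < y) (hA : A.transpose = -A) (t : ℝ) (u v : V)
    (i j : V) :
    skewResolvent y (A + t • skewSingle u v) i j - skewResolvent y A i j =
      -t * (skewResolvent y A i u * skewResolvent y (A + t • skewSingle u v) v j
        - skewResolvent y A i v * skewResolvent y (A + t • skewSingle u v) u j) := by
  have h := congrFun (congrFun (skewResolvent_sub hy hA
    (transpose_add_smul_skewSingle hA t u v)) i) j
  rw [Matrix.sub_apply] at h
  rw [h, show A - (A + t • skewSingle u v) = -(t • skewSingle u v) by abel]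
  set R := skewResolvent y (A + t • skewSingle u v)
  simp only [skewSingle, mul_neg, neg_mul, Matrix.neg_apply, Matrix.mul_smul, Matrix.smul_mul,
    mul_sub, sub_mul, Matrix.smul_apply, Matrix.sub_apply, smul_eq_mul]
  rw [mul_assoc, mul_assoc, Matrix.mul_apply, Matrix.mul_apply,
    Finset.sum_eq_single u, Finset.sum_eq_single v]
  · simp
    ring
  · intro b _ hb
    simp [Matrix.single_mul_apply_of_ne (i := v) (h := hb)]
  · simp
  · intro b _ hb
    simp [Matrix.single_mul_apply_of_ne (i := u) (h := hb)]
  · simp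

theorem abs_skewResolvent_add_smul_sub_le (hy : 0 < y) (hA : A.transpose = -A) (t : ℝ)
    (u v i j : V) :
    |skewResolvent y (A + t • skewSingle u v) i j - skewResolvent y A i j|
      ≤ 2 * |t| * (y⁻¹) ^ 2 := by
  have hB := transpose_add_smul_skewSingle hA t u v
  rw [skewResolvent_add_smul_skewSingle hy hA, abs_mul, abs_neg]
  have h1 := abs_skewResolvent_le hy hA i u
  have h2 := abs_skewResolvent_le hy hA i v
  have h3 := abs_skewResolvent_le hy hB v j
  have h4 := abs_skewResolvent_le hy hB u j
  have hy' : 0 ≤ y⁻¹ := (inv_pos.2 hy).le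
  calc _ ≤ |t| * (y⁻¹ * y⁻¹ + y⁻¹ * y⁻¹) := by
        gcongr
        refine (abs_sub _ _).trans ?_
        rw [abs_mul, abs_mul]
        gcongr
    _ = _ := by ring

theorem abs_sum_mul_le_of_sum_sq_le {V : Type*} [Fintype V] {f g : V → ℝ} {r : ℝ}
    (hf : ∑ i, f i ^ 2 ≤ r ^ 2) (hg : ∑ i, g i ^ 2 ≤ r ^ 2) : |∑ i, f i * g i| ≤ r ^ 2 := by
  refine abs_le_of_sq_le_sq ?_ (by positivity)
  refine (Finset.sum_mul_sq_le_sq_mul_sq _ _ _).trans ?_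
  calc _ ≤ r ^ 2 * r ^ 2 := by gcongr
    _ = _ := by ring

/-- Summing the entrywise bound over the diagonal would lose a factor of the order of the matrix.
Cauchy–Schwarz on a column of one resolvent and a row of the other does not. -/
theorem abs_trace_skewResolvent_sub_le (hy : 0 < y) (hA : A.transpose = -A) (t : ℝ) (u v : V) :
    |(skewResolvent y (A + t • skewSingle u v)).trace - (skewResolvent y A).trace|
      ≤ 2 * |t| * (y⁻¹) ^ 2 := by
  have hB := transpose_add_smul_skewSingle hA t u v
  simp only [Matrix.trace, Matrix.diag_apply, ← Finset.sum_sub_distrib]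
  simp only [skewResolvent_add_smul_skewSingle hy hA, ← Finset.mul_sum, Finset.sum_sub_distrib]
  rw [abs_mul, abs_neg]
  calc _ ≤ |t| * ((y⁻¹) ^ 2 + (y⁻¹) ^ 2) := by
        gcongr
        refine (abs_sub _ _).trans (add_le_add ?_ ?_)
        · exact abs_sum_mul_le_of_sum_sq_le (sum_sq_skewResolvent_col_le hy hA u)
            (sum_sq_skewResolvent_row_le hy hB v)
        · exact abs_sum_mul_le_of_sum_sq_le (sum_sq_skewResolvent_col_le hy hA v)
            (sum_sq_skewResolvent_row_le hy hB u)
    _ = _ := by ring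

/-- The trace of `J R J R` for `J = skewSingle u v`. -/
def pairQuadratic (R : Matrix V V ℝ) (u v : V) : ℝ :=
  R v u ^ 2 + R u v ^ 2 - 2 * (R u u * R v v)

theorem abs_mul_sub_mul_le {a b a' b' r s : ℝ} (ha : |a| ≤ r) (hb' : |b'| ≤ r)
    (h1 : |a' - a| ≤ s) (h2 : |b' - b| ≤ s) : |a' * b' - a * b| ≤ 2 * (r * s) := by
  have hr : 0 ≤ r := (abs_nonneg _).trans ha
  have hs : 0 ≤ s := (abs_nonneg _).trans h1
  calc |a' * b' - a * b| = |a * (b' - b) + (a' - a) * b'| := by congr 1; ring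
    _ ≤ |a| * |b' - b| + |a' - a| * |b'| := by
        rw [← abs_mul, ← abs_mul]; exact abs_add_le _ _
    _ ≤ r * s + s * r := by gcongr
    _ = _ := by ring

theorem abs_pairQuadratic_sub_le (hy : 0 < y) (hA : A.transpose = -A) (t : ℝ) (u v : V) :
    |pairQuadratic (skewResolvent y (A + t • skewSingle u v)) u v
      - pairQuadratic (skewResolvent y A) u v| ≤ 16 * |t| * (y⁻¹) ^ 3 := by
  have hB := transpose_add_smul_skewSingle hA t u v
  have hd := fun i j => abs_skewResolvent_add_smul_sub_le hy hA t u v i j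
  have h1 := abs_mul_sub_mul_le (abs_skewResolvent_le hy hA v u) (abs_skewResolvent_le hy hB v u)
    (hd v u) (hd v u)
  have h2 := abs_mul_sub_mul_le (abs_skewResolvent_le hy hA u v) (abs_skewResolvent_le hy hB u v)
    (hd u v) (hd u v)
  have h3 := abs_mul_sub_mul_le (abs_skewResolvent_le hy hA u u) (abs_skewResolvent_le hy hB v v)
    (hd u u) (hd v v)
  have h4 : y⁻¹ * (2 * |t| * y⁻¹ ^ 2) = 2 * |t| * (y⁻¹) ^ 3 := by ring
  rw [h4] at h1 h2 h3
  rw [abs_le] at h1 h2 h3 ⊢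
  simp only [pairQuadratic]
  constructor <;> linarith [h1.1, h1.2, h2.1, h2.2, h3.1, h3.2]

/-- First-order Taylor expansion in t, with slope -`pairQuadratic`. Replacing the perturbed
resolvent by the original one in the resolvent identity leaves four products, each at most 2|t|y⁻³,
and an outer factor |t|. -/
theorem abs_skewResolvent_expansion_le (hy : 0 < y) (hA : A.transpose = -A) (t : ℝ) (u v : V) :
    |(skewResolvent y (A + t • skewSingle u v) v u - skewResolvent y (A + t • skewSingle u v) u v)
      - (skewResolvent y A v u - skewResolvent y A u v)
      + t * pairQuadratic (skewResolvent y A) u v| ≤ 8 * |t| ^ 2 * (y⁻¹) ^ 3 := by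
  set B := A + t • skewSingle u v with hBdef
  have hd := fun i j => abs_skewResolvent_add_smul_sub_le hy hA t u v i j
  have e1 := skewResolvent_add_smul_skewSingle hy hA t u v v u
  have e2 := skewResolvent_add_smul_skewSingle hy hA t u v u v
  rw [← hBdef] at e1 e2 hd
  have hprod : ∀ i j k l, |skewResolvent y A i j * (skewResolvent y B k l - skewResolvent y A k l)|
      ≤ 2 * |t| * (y⁻¹) ^ 3 := by
    intro i j k l
    rw [abs_mul]
    have hy' : 0 ≤ y⁻¹ := (inv_pos.2 hy).le
    calc _ ≤ y⁻¹ * (2 * |t| * (y⁻¹) ^ 2) := by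
          gcongr
          · exact abs_skewResolvent_le hy hA i j
          · exact hd k l
      _ = _ := by ring
  have key : (skewResolvent y B v u - skewResolvent y B u v)
      - (skewResolvent y A v u - skewResolvent y A u v)
      + t * pairQuadratic (skewResolvent y A) u v
      = -t * (skewResolvent y A v u * (skewResolvent y B v u - skewResolvent y A v u)
        + skewResolvent y A u v * (skewResolvent y B u v - skewResolvent y A u v)
        - skewResolvent y A v v * (skewResolvent y B u u - skewResolvent y A u u)
        - skewResolvent y A u u * (skewResolvent y B v v - skewResolvent y A v v)) := by
    simp only [pairQuadratic]
    linear_combination e1 - e2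
  rw [key, abs_mul, abs_neg]
  have h1 := hprod v u v u
  have h2 := hprod u v u v
  have h3 := hprod v v u u
  have h4 := hprod u u v v
  calc _ ≤ |t| * (4 * (2 * |t| * (y⁻¹) ^ 3)) := by
        gcongr
        rw [abs_le] at h1 h2 h3 h4 ⊢
        constructor <;> linarith [h1.1, h1.2, h2.1, h2.2, h3.1, h3.2, h4.1, h4.2]
    _ = _ := by ring

/-- The squares add up by the Ward identity on rows and the products factor into the squared trace.
The diagonal terms are zero, so this is the sum of `pairQuadratic` over unordered pairs. -/
theorem sum_pairQuadratic (hy : 0 < y) (hA : A.transpose = -A) :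
    ∑ u, ∑ v, (skewResolvent y A u v ^ 2 - skewResolvent y A u u * skewResolvent y A v v)
      = y⁻¹ * (skewResolvent y A).trace - (skewResolvent y A).trace ^ 2 := by
  simp only [Finset.sum_sub_distrib]
  congr 1
  · rw [Matrix.trace, Finset.mul_sum]
    refine Finset.sum_congr rfl fun u _ => ?_
    rw [Matrix.diag_apply, ← sum_sq_skewResolvent_row hy hA u, inv_mul_cancel_left₀ hy.ne']
  · rw [pow_two, Matrix.trace, Finset.sum_mul_sum]
    rfl

theorem trace_skewResolvent_nonneg (hy : 0 < y) (hA : A.transpose = -A) :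
    0 ≤ (skewResolvent y A).trace :=
  Finset.sum_nonneg fun v _ => skewResolvent_diag_nonneg hy hA v

theorem trace_skewResolvent_le (hy : 0 < y) (hA : A.transpose = -A) :
    (skewResolvent y A).trace ≤ Fintype.card V * y⁻¹ := by
  calc _ ≤ ∑ _v : V, y⁻¹ := Finset.sum_le_sum fun v _ => skewResolvent_diag_le hy hA v
    _ = _ := by simp

end SkewResolvent

/-! ### Skew matrices with independent entries: self-consistent equation and concentration -/

section RandomSkewMatrix

open OrientedGraph

/-- The skew-symmetric matrix with given entries above the diagonal. -/
def skewOfPairs {n : ℕ} (f : VertexPair n → ℝ) : Matrix (Fin n) (Fin n) ℝ :=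
  Matrix.of fun u v => if h : u < v then f ⟨(u, v), h⟩ else if h : v < u then -f ⟨(v, u), h⟩ else 0

variable {n : ℕ}

theorem skewOfPairs_apply_of_lt (f : VertexPair n → ℝ) {u v : Fin n} (h : u < v) :
    skewOfPairs f u v = f ⟨(u, v), h⟩ := by
  simp [skewOfPairs, h]

theorem skewOfPairs_apply_of_gt (f : VertexPair n → ℝ) {u v : Fin n} (h : v < u) :
    skewOfPairs f u v = -f ⟨(v, u), h⟩ := by
  simp [skewOfPairs, h, h.not_gt]

theorem skewOfPairs_apply_self (f : VertexPair n → ℝ) (u : Fin n) : skewOfPairs f u u = 0 := by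
  simp [skewOfPairs]

theorem skewOfPairs_transpose (f : VertexPair n → ℝ) :
    (skewOfPairs f).transpose = -skewOfPairs f := by
  ext u v
  rw [Matrix.transpose_apply, Matrix.neg_apply]
  rcases lt_trichotomy u v with h | rfl | h
  · rw [skewOfPairs_apply_of_lt f h, skewOfPairs_apply_of_gt f h]
  · simp [skewOfPairs_apply_self]
  · rw [skewOfPairs_apply_of_lt f h, skewOfPairs_apply_of_gt f h, neg_neg]

/-- Isolates the dependence on one pair: a matrix not involving that entry, plus a rank-two term
linear in it. -/
theorem skewOfPairs_update (f : VertexPair n → ℝ) (e : VertexPair n) (r : ℝ) :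
    skewOfPairs (Function.update f e r)
      = skewOfPairs (Function.update f e 0) + r • skewSingle e.1.1 e.1.2 := by
  obtain ⟨⟨i, j⟩, hij⟩ := e
  simp only at hij
  ext u v
  simp only [Matrix.add_apply, Matrix.smul_apply, skewSingle, Matrix.sub_apply, Matrix.single_apply,
    smul_eq_mul]
  rcases lt_trichotomy u v with h | rfl | h
  · rw [skewOfPairs_apply_of_lt _ h, skewOfPairs_apply_of_lt _ h]
    have h2 : ¬ (j = u ∧ i = v) := by rintro ⟨rfl, rfl⟩; exact lt_asymm h hij
    by_cases h1 : i = u ∧ j = v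
    · obtain ⟨rfl, rfl⟩ := h1
      simp [h2]
    · rw [Function.update_of_ne, Function.update_of_ne]
      · simp [h1, h2]
      all_goals
        intro h3
        simp only [Subtype.mk.injEq, Prod.mk.injEq] at h3
        exact h1 ⟨h3.1.symm, h3.2.symm⟩
  · rw [skewOfPairs_apply_self, skewOfPairs_apply_self]
    have h1 : ¬ (i = u ∧ j = u) := by rintro ⟨rfl, rfl⟩; exact lt_irrefl _ hij
    have h2 : ¬ (j = u ∧ i = u) := fun h => h1 h.symm
    simp [h1, h2]
  · rw [skewOfPairs_apply_of_gt _ h, skewOfPairs_apply_of_gt _ h]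
    have h2 : ¬ (i = u ∧ j = v) := by rintro ⟨rfl, rfl⟩; exact lt_asymm h hij
    by_cases h1 : j = u ∧ i = v
    · obtain ⟨rfl, rfl⟩ := h1
      simp [h2]
    · rw [Function.update_of_ne, Function.update_of_ne]
      · simp [h1, h2]
      all_goals
        intro h3
        simp only [Subtype.mk.injEq, Prod.mk.injEq] at h3
        exact h1 ⟨h3.2.symm, h3.1.symm⟩

theorem sum_sum_eq_sum_vertexPair (h : Fin n → Fin n → ℝ) (h0 : ∀ u, h u u = 0) :
    ∑ u, ∑ v, h u v = ∑ e : VertexPair n, (h e.1.1 e.1.2 + h e.1.2 e.1.1) := by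
  have h1 : ∀ k : Fin n → Fin n → ℝ, ∑ e : VertexPair n, k e.1.1 e.1.2
      = ∑ u, ∑ v, if u < v then k u v else 0 := by
    intro k
    rw [← Fintype.sum_prod_type' (f := fun u v => if u < v then k u v else 0), ← Finset.sum_filter]
    exact (Finset.sum_subtype (Finset.univ.filter fun q : Fin n × Fin n => q.1 < q.2) (by simp)
      (fun q => k q.1 q.2)).symm
  rw [Finset.sum_add_distrib, h1 h, h1 fun u v => h v u,
    Finset.sum_comm (f := fun u v => if u < v then h v u else 0), ← Finset.sum_add_distrib]
  refine Finset.sum_congr rfl fun u _ => ?_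
  rw [← Finset.sum_add_distrib]
  refine Finset.sum_congr rfl fun v _ => ?_
  rcases lt_trichotomy u v with h | rfl | h
  · simp [h, h.not_gt]
  · simp [h0]
  · simp [h, h.not_gt]

theorem card_vertexPair_le : Fintype.card (VertexPair n) ≤ n ^ 2 := by
  refine (Fintype.card_subtype_le _).trans ?_
  simp [pow_two]

variable {α : Type*}

/-- The normalized trace of the resolvent of the matrix with entries `t (c e)`. -/
def resolventMean (y : ℝ) (t : α → ℝ) (c : VertexPair n → α) : ℝ :=
  (1 / (n : ℝ)) * (skewResolvent y (skewOfPairs (t ∘ c))).trace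

variable {y a : ℝ} {t : α → ℝ}

theorem resolventMean_nonneg (hy : 0 < y) (c : VertexPair n → α) : 0 ≤ resolventMean y t c :=
  mul_nonneg (by positivity) (trace_skewResolvent_nonneg hy (skewOfPairs_transpose _))

theorem resolventMean_le (hy : 0 < y) (c : VertexPair n → α) : resolventMean y t c ≤ y⁻¹ := by
  have h := trace_skewResolvent_le hy (skewOfPairs_transpose (t ∘ c))
  rw [Fintype.card_fin] at h
  rcases Nat.eq_zero_or_pos n with rfl | hn
  · simp [resolventMean, hy.le]
  · have hn' : (0 : ℝ) < n := by exact_mod_cast hn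
    unfold resolventMean
    calc _ ≤ (1 / (n : ℝ)) * (n * y⁻¹) := by gcongr
      _ = _ := by field_simp

theorem skewOfPairs_comp_update {x₀ : α} (hx₀ : t x₀ = 0) (c : VertexPair n → α)
    (e : VertexPair n) (x : α) :
    skewOfPairs (t ∘ Function.update c e x)
      = skewOfPairs (t ∘ Function.update c e x₀) + t x • skewSingle e.1.1 e.1.2 := by
  rw [Function.comp_update, Function.comp_update, hx₀, skewOfPairs_update]

/-- The bound keeps the actual value t (c e) rather than its maximum, so that its weighted square
sees the variance. -/
theorem abs_resolventMean_sub_update_le (hy : 0 < y) {x₀ : α} (hx₀ : t x₀ = 0)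
    (c : VertexPair n → α) (e : VertexPair n) :
    |resolventMean y t c - resolventMean y t (Function.update c e x₀)|
      ≤ 2 * |t (c e)| * (y⁻¹) ^ 2 / n := by
  have h := abs_trace_skewResolvent_sub_le hy
    (skewOfPairs_transpose (t ∘ Function.update c e x₀)) (t (c e)) e.1.1 e.1.2
  rw [← skewOfPairs_comp_update hx₀ c e (c e), Function.update_eq_self] at h
  unfold resolventMean
  rw [← mul_sub, abs_mul, abs_of_nonneg (by positivity : (0 : ℝ) ≤ 1 / n), one_div,
    div_eq_inv_mul]
  gcongr

/-- Exact combination of `skewResolvent_trace_eq` and `sum_pairQuadratic`. In each summand on the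
left the two terms cancel to leading order on average, so the mean of the right side, without its
factor n, is the small defect in the quadratic equation. -/
theorem resolventMean_identity (hy : 0 < y) (hn : 0 < n) (c : VertexPair n → α)
    (R : (VertexPair n → α) → Matrix (Fin n) (Fin n) ℝ)
    (hR : R = fun c => skewResolvent y (skewOfPairs (t ∘ c))) :
    ∑ e : VertexPair n, (t (c e) * (R c e.1.2 e.1.1 - R c e.1.1 e.1.2)
        + 1 / n * pairQuadratic (R c) e.1.1 e.1.2)
      = n * (1 + y⁻¹ / n * resolventMean y t c - y * resolventMean y t c
          - resolventMean y t c ^ 2) := by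
  have hA := skewOfPairs_transpose (t ∘ c)
  have hn' : (n : ℝ) ≠ 0 := by exact_mod_cast hn.ne'
  have hRc : R c = skewResolvent y (skewOfPairs (t ∘ c)) := by rw [hR]
  have h1 := skewResolvent_trace_eq hy hA
  have h2 := sum_pairQuadratic hy hA
  rw [sum_sum_eq_sum_vertexPair _ (by simp [skewOfPairs_apply_self]), Fintype.card_fin] at h1
  rw [sum_sum_eq_sum_vertexPair (fun u v => skewResolvent y (skewOfPairs (t ∘ c)) u v ^ 2
    - skewResolvent y (skewOfPairs (t ∘ c)) u u * skewResolvent y (skewOfPairs (t ∘ c)) v v)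
    (fun u => by ring)] at h2
  have h3 : (skewResolvent y (skewOfPairs (t ∘ c))).trace = n * resolventMean y t c := by
    rw [resolventMean]; field_simp
  rw [h3] at h1 h2
  rw [Finset.sum_add_distrib, ← Finset.mul_sum, hRc]
  have h4 : ∑ e : VertexPair n, (t (c e) * (skewResolvent y (skewOfPairs (t ∘ c)) e.1.2 e.1.1
      - skewResolvent y (skewOfPairs (t ∘ c)) e.1.1 e.1.2))
      = n - y * (n * resolventMean y t c) := by
    rw [eq_sub_iff_add_eq']
    refine Eq.trans ?_ h1
    refine congrArg (fun z => y * (n * resolventMean y t c) + z) ?_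
    refine Finset.sum_congr rfl fun e _ => ?_
    rw [skewOfPairs_apply_of_lt _ e.2, skewOfPairs_apply_of_gt _ e.2, Function.comp_apply]
    ring
  have h5 : ∑ e : VertexPair n, pairQuadratic (skewResolvent y (skewOfPairs (t ∘ c))) e.1.1 e.1.2
      = y⁻¹ * (n * resolventMean y t c) - (n * resolventMean y t c) ^ 2 := by
    rw [← h2]
    refine Finset.sum_congr rfl fun e _ => ?_
    simp only [pairQuadratic]
    ring
  rw [h4, h5]
  field_simp
  ring

variable [Fintype α] {w : α → ℝ}

/-- Averaging over the single pair e. The mean of t removes the zeroth-order term and its variance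
1/n makes the first-order term cancel the added quadratic one. The remainders contribute 8 (Taylor)
and 16 (variation of `pairQuadratic`). -/
theorem abs_sum_edge_le (hy : 0 < y) {x₀ : α} (hx₀ : t x₀ = 0) (hw : ∀ x, 0 ≤ w x)
    (hw1 : ∑ x, w x = 1) (ht1 : ∑ x, w x * t x = 0) (ht2 : ∑ x, w x * t x ^ 2 = 1 / n)
    (ha : ∀ x, |t x| ≤ a) (c : VertexPair n → α) (e : VertexPair n)
    (R : (VertexPair n → α) → Matrix (Fin n) (Fin n) ℝ)
    (hR : R = fun c => skewResolvent y (skewOfPairs (t ∘ c))) :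
    |∑ x, w x * (t (Function.update c e x e) * (R (Function.update c e x) e.1.2 e.1.1
        - R (Function.update c e x) e.1.1 e.1.2)
        + 1 / n * pairQuadratic (R (Function.update c e x)) e.1.1 e.1.2)|
      ≤ 24 * a * (y⁻¹) ^ 3 / n := by
  have hA := skewOfPairs_transpose (t ∘ Function.update c e x₀)
  obtain ⟨⟨u, v⟩, huv⟩ := e
  set e : VertexPair n := ⟨(u, v), huv⟩ with he
  simp only [Function.update_self]
  have h1 : ∀ x, R (Function.update c e x)
      = skewResolvent y (skewOfPairs (t ∘ Function.update c e x₀) + t x • skewSingle u v) :=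
    fun x => by rw [hR]; simp only; rw [skewOfPairs_comp_update hx₀ c e x]
  simp only [h1]
  set A := skewOfPairs (t ∘ Function.update c e x₀)
  set g : ℝ := skewResolvent y A v u - skewResolvent y A u v
  set q : ℝ := pairQuadratic (skewResolvent y A) u v
  have hE := fun x => abs_skewResolvent_expansion_le hy hA (t x) u v
  have hQ := fun x => abs_pairQuadratic_sub_le hy hA (t x) u v
  have ha0 : 0 ≤ a := (abs_nonneg _).trans (ha x₀)
  have hy' : 0 ≤ y⁻¹ := (inv_pos.2 hy).le
  set G : α → ℝ := fun x => skewResolvent y (A + t x • skewSingle u v) v u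
    - skewResolvent y (A + t x • skewSingle u v) u v
  set Q : α → ℝ := fun x => pairQuadratic (skewResolvent y (A + t x • skewSingle u v)) u v
  -- Inserting g and q, the values at entry 0, changes nothing: -g ∑ w t = 0 and q ∑ w t² = q/n.
  have key : ∑ x, w x * (t x * G x + 1 / n * Q x)
      = ∑ x, w x * (t x * (G x - g + t x * q) + 1 / n * (Q x - q)) := by
    have h2 : ∀ x, w x * (t x * (G x - g + t x * q) + 1 / n * (Q x - q))
        = w x * (t x * G x + 1 / n * Q x) - g * (w x * t x) + q * (w x * t x ^ 2)
          - (1 / n * q) * w x := fun x => by ring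
    simp only [h2, Finset.sum_add_distrib, Finset.sum_sub_distrib, ← Finset.mul_sum, hw1, ht1, ht2]
    ring
  rw [key]
  calc _ ≤ ∑ x, |w x * (t x * (G x - g + t x * q) + 1 / n * (Q x - q))| :=
        Finset.abs_sum_le_sum_abs _ _
    _ ≤ ∑ x, (8 * a * (y⁻¹) ^ 3 * (w x * t x ^ 2) + 16 * a * (y⁻¹) ^ 3 / n * w x) := by
        refine Finset.sum_le_sum fun x _ => ?_
        rw [abs_mul, abs_of_nonneg (hw x)]
        calc _ ≤ w x * (|t x| * (8 * |t x| ^ 2 * (y⁻¹) ^ 3)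
              + 1 / n * (16 * |t x| * (y⁻¹) ^ 3)) := by
              refine mul_le_mul_of_nonneg_left ?_ (hw x)
              refine (abs_add_le _ _).trans ?_
              rw [abs_mul, abs_mul, abs_of_nonneg (by positivity : (0 : ℝ) ≤ 1 / n)]
              gcongr
              · exact hE x
              · exact hQ x
          _ ≤ w x * (a * (8 * |t x| ^ 2 * (y⁻¹) ^ 3) + 1 / n * (16 * a * (y⁻¹) ^ 3)) := by
              have := ha x
              have := hw x
              gcongr
          _ = _ := by rw [sq_abs]; ring
    _ = 24 * a * (y⁻¹) ^ 3 / n := by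
        rw [Finset.sum_add_distrib, ← Finset.mul_sum, ← Finset.mul_sum, hw1, ht2]
        ring

/-- The approximate quadratic equation for the mean of the normalized trace of the resolvent. -/
theorem abs_selfConsistent_le (hy : 0 < y) (hn : 0 < n) {x₀ : α} (hx₀ : t x₀ = 0)
    (hw : ∀ x, 0 ≤ w x)
    (hw1 : ∑ x, w x = 1) (ht1 : ∑ x, w x * t x = 0) (ht2 : ∑ x, w x * t x ^ 2 = 1 / n)
    (ha : ∀ x, |t x| ≤ a) :
    |1 + y⁻¹ / n * productExpectation w (resolventMean (n := n) y t)
        - y * productExpectation w (resolventMean (n := n) y t)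
        - productExpectation w (fun c : VertexPair n → α => resolventMean y t c ^ 2)|
      ≤ 24 * a * (y⁻¹) ^ 3 := by
  have hn' : (0 : ℝ) < n := by exact_mod_cast hn
  have ha0 : 0 ≤ a := (abs_nonneg _).trans (ha x₀)
  set R : (VertexPair n → α) → Matrix (Fin n) (Fin n) ℝ :=
    fun c => skewResolvent y (skewOfPairs (t ∘ c)) with hR
  set T : VertexPair n → (VertexPair n → α) → ℝ := fun e c =>
    t (c e) * (R c e.1.2 e.1.1 - R c e.1.1 e.1.2) + 1 / n * pairQuadratic (R c) e.1.1 e.1.2 with hT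
  have h1 : ∀ e, |productExpectation w (T e)| ≤ 24 * a * (y⁻¹) ^ 3 / n := by
    intro e
    rw [← productExpectation.resample hw1 e]
    exact productExpectation.abs_le hw hw1 fun c =>
      abs_sum_edge_le hy hx₀ hw hw1 ht1 ht2 ha c e R hR
  have h2 : productExpectation w (fun c => ∑ e, T e c)
      = n * (1 + y⁻¹ / n * productExpectation w (resolventMean (n := n) y t)
        - y * productExpectation w (resolventMean (n := n) y t)
        - productExpectation w (fun c : VertexPair n → α => resolventMean y t c ^ 2)) := by
    have h3 : (fun c => ∑ e, T e c) = fun c => n * (1 + y⁻¹ / n * resolventMean y t c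
        - y * resolventMean y t c - resolventMean y t c ^ 2) :=
      funext fun c => resolventMean_identity hy hn c R hR
    rw [h3, productExpectation.const_mul, productExpectation.sub, productExpectation.sub,
      productExpectation.add, productExpectation.const hw1, productExpectation.const_mul,
      productExpectation.const_mul]
  rw [productExpectation.sum] at h2
  have h4 : |(n : ℝ) * (1 + y⁻¹ / n * productExpectation w (resolventMean (n := n) y t)
        - y * productExpectation w (resolventMean (n := n) y t)
        - productExpectation w (fun c : VertexPair n → α => resolventMean y t c ^ 2))|
      ≤ n * (24 * a * (y⁻¹) ^ 3) := by
    rw [← h2]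
    calc _ ≤ ∑ e, |productExpectation w (T e)| := Finset.abs_sum_le_sum_abs _ _
      _ ≤ ∑ _e : VertexPair n, 24 * a * (y⁻¹) ^ 3 / n := Finset.sum_le_sum fun e _ => h1 e
      _ = Fintype.card (VertexPair n) * (24 * a * (y⁻¹) ^ 3 / n) := by simp
      -- There are at most n² pairs with error of order a/n each; dividing the total by the factor n
      -- of the identity leaves order a.
      _ ≤ ((n ^ 2 : ℕ) : ℝ) * (24 * a * (y⁻¹) ^ 3 / n) := by
          have : (Fintype.card (VertexPair n) : ℝ) ≤ ((n ^ 2 : ℕ) : ℝ) := by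
            exact_mod_cast card_vertexPair_le
          gcongr
      _ = _ := by push_cast; field_simp
  rw [abs_mul, abs_of_pos hn'] at h4
  exact le_of_mul_le_mul_left h4 hn'

/-- Each pair contributes 4l²y⁻⁴/n² times the variance 1/n, and there are at most n² pairs. The
maximal entry a only restricts l; in the exponent it would give a² in place of 1/n, that is 1/(np)
in the application, too weak for summability when np grows slowly. -/
theorem productExpectation_exp_resolventMean_le (hy : 0 < y) (hn : 0 < n) {x₀ : α}
    (hx₀ : t x₀ = 0) (hw : ∀ x, 0 ≤ w x) (hw1 : ∑ x, w x = 1)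
    (ht2 : ∑ x, w x * t x ^ 2 = 1 / n) (ha : ∀ x, |t x| ≤ a) (l : ℝ)
    (hl : |l| * (2 * a * (y⁻¹) ^ 2 / n) ≤ 1) :
    productExpectation w (fun c : VertexPair n → α => Real.exp (l * (resolventMean y t c
        - productExpectation w (resolventMean (n := n) y t))))
      ≤ Real.exp (4 * l ^ 2 * (y⁻¹) ^ 4 / n) := by
  have hn' : (0 : ℝ) < n := by exact_mod_cast hn
  have h := productExpectation.exp_sub_le (ι := VertexPair n) hw hw1 x₀
    (d := fun x => |l| * (2 * |t x| * (y⁻¹) ^ 2 / n)) (fun x => by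
      refine le_trans ?_ hl
      have := ha x
      gcongr) (fun c => l * resolventMean y t c) (fun c e => by
        rw [← mul_sub, abs_mul]
        exact mul_le_mul_of_nonneg_left (abs_resolventMean_sub_update_le hy hx₀ c e)
          (abs_nonneg _))
  rw [productExpectation.const_mul] at h
  simp only [mul_sub]
  refine h.trans (Real.exp_le_exp.2 ?_)
  have h2 : ∑ x, w x * (|l| * (2 * |t x| * (y⁻¹) ^ 2 / n)) ^ 2
      = 4 * l ^ 2 * (y⁻¹) ^ 4 / n ^ 2 * (1 / n) := by
    rw [← ht2, Finset.mul_sum]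
    refine Finset.sum_congr rfl fun x _ => ?_
    simp only [mul_pow, div_pow, sq_abs]
    ring
  rw [h2]
  have : (Fintype.card (VertexPair n) : ℝ) ≤ ((n ^ 2 : ℕ) : ℝ) := by
    exact_mod_cast card_vertexPair_le
  calc _ ≤ ((n ^ 2 : ℕ) : ℝ) * (4 * l ^ 2 * (y⁻¹) ^ 4 / n ^ 2 * (1 / n)) := by gcongr
    _ = _ := by push_cast; field_simp

end RandomSkewMatrix

/-! ### The semicircle law and its transform -/

section Semicircle

/-- `Real.sqrt` vanishes on negative numbers, so the cutoff at |x| = 2 is automatic. -/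
theorem semicircleDensity_eq (x : ℝ) :
    semicircleDensity x = 1 / (2 * Real.pi) * Real.sqrt (4 - x ^ 2) := by
  unfold semicircleDensity
  split_ifs with h
  · rfl
  · rw [Real.sqrt_eq_zero_of_nonpos, mul_zero]
    have := (one_lt_sq_iff_one_lt_abs (x / 2)).2 (by rw [abs_div, abs_two]; linarith)
    nlinarith

theorem continuous_semicircleDensity : Continuous semicircleDensity := by
  rw [funext semicircleDensity_eq]
  fun_prop

theorem semicircleDensity_nonneg (x : ℝ) : 0 ≤ semicircleDensity x := by
  rw [semicircleDensity_eq]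
  positivity

theorem semicircleDensity_eq_zero {x : ℝ} (hx : x ∉ Set.Ioc (-2 : ℝ) 2) :
    semicircleDensity x = 0 := by
  rw [semicircleDensity_eq, Real.sqrt_eq_zero_of_nonpos, mul_zero]
  rw [Set.mem_Ioc, not_and_or, not_lt, not_le] at hx
  rcases hx with h | h <;> nlinarith

theorem integral_semicircleDensity_smul {E : Type*} [NormedAddCommGroup E] [NormedSpace ℝ E]
    (g : ℝ → E) :
    ∫ x, semicircleDensity x • g x = ∫ x in (-2 : ℝ)..2, semicircleDensity x • g x := by
  refine (intervalIntegral.integral_eq_integral_of_support_subset fun x hx => ?_).symm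
  by_contra h
  exact hx (by simp [semicircleDensity_eq_zero h])

theorem integrable_semicircleDensity_smul {E : Type*} [NormedAddCommGroup E] [NormedSpace ℝ E]
    {g : ℝ → E} (hg : Continuous g) : Integrable fun x => semicircleDensity x • g x := by
  refine Continuous.integrable_of_hasCompactSupport (continuous_semicircleDensity.smul hg) ?_
  refine HasCompactSupport.intro (isCompact_Icc (a := (-2 : ℝ)) (b := 2)) fun x hx => ?_
  rw [semicircleDensity_eq_zero fun h => hx (Set.Ioc_subset_Icc_self h), zero_smul]

theorem integrable_semicircleDensity : Integrable semicircleDensity := by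
  simpa using integrable_semicircleDensity_smul (E := ℝ) (g := fun _ => 1) continuous_const

theorem integral_semicircleDensity : ∫ x, semicircleDensity x = 1 := by
  have h := integral_semicircleDensity_smul (E := ℝ) (fun _ => 1)
  simp only [smul_eq_mul, mul_one] at h
  rw [h]
  have h1 : ∀ x : ℝ, semicircleDensity x = 1 / Real.pi * Real.sqrt (1 - (x / 2) ^ 2) := by
    intro x
    rw [semicircleDensity_eq, show (4 : ℝ) - x ^ 2 = 2 ^ 2 * (1 - (x / 2) ^ 2) by ring,
      Real.sqrt_mul (by norm_num), Real.sqrt_sq (by norm_num)]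
    field_simp
  simp only [h1]
  rw [intervalIntegral.integral_const_mul,
    intervalIntegral.integral_comp_div (fun x => Real.sqrt (1 - x ^ 2)) two_ne_zero]
  norm_num [integral_sqrt_one_sub_sq]
  field_simp

/-- The explicit primitive works because, with c = √(4 + y²), s = √(4 - x²) and r = √(x² + y²), 1 -
(xc/2r)² = (ys/2r)²; the derivatives of both arcsines become rational in c, s, r. -/
theorem hasDerivAt_semicircle_primitive {y x : ℝ} (hy : 0 < y) (hx : x ∈ Set.Ioo (-2 : ℝ) 2) :
    HasDerivAt (fun x => Real.sqrt (4 + y ^ 2) / y *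
        Real.arcsin (x * Real.sqrt (4 + y ^ 2) / (2 * Real.sqrt (x ^ 2 + y ^ 2)))
        - Real.arcsin (x / 2))
      (Real.sqrt (4 - x ^ 2) / (x ^ 2 + y ^ 2)) x := by
  have hs : 0 < 4 - x ^ 2 := by nlinarith [hx.1, hx.2]
  have hr : 0 < x ^ 2 + y ^ 2 := by positivity
  have hc : 0 < 4 + y ^ 2 := by positivity
  set c := Real.sqrt (4 + y ^ 2) with hcdef
  set s := Real.sqrt (4 - x ^ 2) with hsdef
  set r := Real.sqrt (x ^ 2 + y ^ 2) with hrdef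
  have hc2 : c ^ 2 = 4 + y ^ 2 := Real.sq_sqrt hc.le
  have hs2 : s ^ 2 = 4 - x ^ 2 := Real.sq_sqrt hs.le
  have hr2 : r ^ 2 = x ^ 2 + y ^ 2 := Real.sq_sqrt hr.le
  have hc0 : 0 < c := Real.sqrt_pos.2 hc
  have hs0 : 0 < s := Real.sqrt_pos.2 hs
  have hr0 : 0 < r := Real.sqrt_pos.2 hr
  have h1 : 1 - (x * c / (2 * r)) ^ 2 = (y * s / (2 * r)) ^ 2 := by
    field_simp
    rw [hc2, hs2, hr2]
    ring
  have h2 : Real.sqrt (1 - (x * c / (2 * r)) ^ 2) = y * s / (2 * r) := by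
    rw [h1, Real.sqrt_sq (by positivity)]
  have h3 : Real.sqrt (1 - (x / 2) ^ 2) = s / 2 := by
    rw [show 1 - (x / 2) ^ 2 = (s / 2) ^ 2 by rw [div_pow, div_pow, hs2]; ring,
      Real.sqrt_sq (by positivity)]
  have hlt : (x * c / (2 * r)) ^ 2 < 1 := by
    have : 0 < (y * s / (2 * r)) ^ 2 := by positivity
    linarith
  have hlt' : (x / 2) ^ 2 < 1 := by nlinarith
  have hne : ∀ {z : ℝ}, z ^ 2 < 1 → z ≠ -1 ∧ z ≠ 1 := by
    intro z hz
    constructor <;> rintro rfl <;> norm_num at hz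
  have hdr : HasDerivAt (fun x => Real.sqrt (x ^ 2 + y ^ 2)) (x / r) x := by
    have h := ((hasDerivAt_pow 2 x).add_const (y ^ 2)).sqrt hr.ne'
    convert h using 1
    rw [← hrdef]
    field_simp
    simp [mul_comm]
  have hdu : HasDerivAt (fun x => x * c / (2 * Real.sqrt (x ^ 2 + y ^ 2)))
      ((1 * c * (2 * r) - x * c * (2 * (x / r))) / (2 * r) ^ 2) x :=
    ((hasDerivAt_id x).mul_const c).div (hdr.const_mul 2) (by positivity)
  have hd1 := (Real.hasDerivAt_arcsin (hne hlt).1 (hne hlt).2).comp x hdu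
  have hd2 := (Real.hasDerivAt_arcsin (hne hlt').1 (hne hlt').2).comp x
    ((hasDerivAt_id x).div_const 2)
  have hd := (hd1.const_mul (c / y)).sub hd2
  rw [h2, h3] at hd
  refine hd.congr_deriv ?_
  rw [← hr2]
  field_simp
  have h4 : r ^ 2 - x ^ 2 = y ^ 2 := by rw [hr2]; ring
  rw [h4, hs2, hr2, hc2]
  ring

theorem integral_sqrt_div_sq_add_sq {y : ℝ} (hy : 0 < y) :
    ∫ x in (-2 : ℝ)..2, Real.sqrt (4 - x ^ 2) / (x ^ 2 + y ^ 2)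
      = Real.pi * (Real.sqrt (4 + y ^ 2) / y - 1) := by
  have hr : ∀ x : ℝ, 0 < x ^ 2 + y ^ 2 := fun x => by positivity
  have hc0 : Real.sqrt (4 + y ^ 2) ≠ 0 := (Real.sqrt_pos.2 (by positivity)).ne'
  -- At x = ±2 both arcsines have argument ±1, where they are not differentiable; continuity on the
  -- closed interval suffices.
  rw [intervalIntegral.integral_eq_sub_of_hasDerivAt_of_le (by norm_num) (f := fun x =>
      Real.sqrt (4 + y ^ 2) / y *
        Real.arcsin (x * Real.sqrt (4 + y ^ 2) / (2 * Real.sqrt (x ^ 2 + y ^ 2)))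
        - Real.arcsin (x / 2)) ?_ (fun x hx => hasDerivAt_semicircle_primitive hy hx) ?_]
  · have h1 : (2 : ℝ) * Real.sqrt (4 + y ^ 2) / (2 * Real.sqrt (2 ^ 2 + y ^ 2)) = 1 := by
      norm_num; exact hc0
    have h2 : (-2 : ℝ) * Real.sqrt (4 + y ^ 2) / (2 * Real.sqrt ((-2) ^ 2 + y ^ 2)) = -1 := by
      have : ((-2 : ℝ)) ^ 2 = 2 ^ 2 := by norm_num
      rw [this, neg_mul, neg_div, h1]
    rw [h1, h2]
    norm_num
    ring
  · refine Continuous.continuousOn ?_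
    have hrs : ∀ x : ℝ, 2 * Real.sqrt (x ^ 2 + y ^ 2) ≠ 0 := fun x => by
      have := Real.sqrt_pos.2 (hr x)
      positivity
    exact (continuous_const.mul (Real.continuous_arcsin.comp
      (Continuous.div (by fun_prop) (by fun_prop) hrs))).sub
      (Real.continuous_arcsin.comp (by fun_prop))
  · exact (Continuous.div (by fun_prop) (by fun_prop) fun x => (hr x).ne').intervalIntegrable _ _

theorem add_mul_I_ne_zero {y : ℝ} (hy : y ≠ 0) (x : ℝ) : (y : ℂ) + x * Complex.I ≠ 0 := by
  intro h
  have := congrArg Complex.re h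
  simp at this
  exact hy this

theorem continuous_inv_add_mul_I {y : ℝ} (hy : y ≠ 0) :
    Continuous fun x : ℝ => ((y : ℂ) + x * Complex.I)⁻¹ :=
  Continuous.inv₀ (by fun_prop) (add_mul_I_ne_zero hy)

/-- The density is even, so averaging x and -x replaces the kernel by the real function y/(x² + y²).
-/
theorem integral_semicircleDensity_smul_inv {y : ℝ} (hy : 0 < y) :
    ∫ x, semicircleDensity x • ((y : ℂ) + x * Complex.I)⁻¹
      = (((Real.sqrt (4 + y ^ 2) - y) / 2 : ℝ) : ℂ) := by
  set J := ∫ x, semicircleDensity x • ((y : ℂ) + x * Complex.I)⁻¹ with hJ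
  have hi := integrable_semicircleDensity_smul (continuous_inv_add_mul_I hy.ne')
  have h1 : J = ∫ x, semicircleDensity x • ((y : ℂ) + (-x : ℝ) * Complex.I)⁻¹ := by
    rw [hJ, ← integral_neg_eq_self]
    refine integral_congr_ae (Eventually.of_forall fun x => ?_)
    simp only [semicircleDensity_eq, neg_sq]
  have h2 : J + J = ∫ x, (semicircleDensity x • (2 * y / (x ^ 2 + y ^ 2)) : ℝ) := by
    nth_rw 2 [h1]
    rw [hJ, ← integral_add hi, ← integral_complex_ofReal]
    · refine integral_congr_ae (Eventually.of_forall fun x => ?_)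
      have e1 := add_mul_I_ne_zero hy.ne' x
      have e2 := add_mul_I_ne_zero hy.ne' (-x)
      have e3 : ((x : ℂ) ^ 2 + y ^ 2) ≠ 0 := by
        have : x ^ 2 + y ^ 2 ≠ 0 := by positivity
        exact_mod_cast this
      have e4 : ((y : ℂ) + x * Complex.I)⁻¹ + ((y : ℂ) + (-x : ℝ) * Complex.I)⁻¹
          = 2 * y / (x ^ 2 + y ^ 2) := by
        rw [inv_add_inv e1 e2]
        congr 1
        · push_cast; ring
        · push_cast; ring_nf; rw [Complex.I_sq]; ring
      simp only [smul_eq_mul]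
      rw [← smul_add, e4, Complex.real_smul]
      push_cast
      rfl
    · have := hi.comp_neg
      refine this.congr (Eventually.of_forall fun x => ?_)
      simp only [semicircleDensity_eq, neg_sq]
  have h3 : ∫ x, (semicircleDensity x • (2 * y / (x ^ 2 + y ^ 2)) : ℝ)
      = Real.sqrt (4 + y ^ 2) - y := by
    rw [integral_semicircleDensity_smul]
    have h4 : ∀ x : ℝ, (semicircleDensity x • (2 * y / (x ^ 2 + y ^ 2)) : ℝ)
        = y / Real.pi * (Real.sqrt (4 - x ^ 2) / (x ^ 2 + y ^ 2)) := by
      intro x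
      rw [semicircleDensity_eq, smul_eq_mul]
      have := Real.pi_pos
      field_simp
    simp only [h4]
    rw [intervalIntegral.integral_const_mul, integral_sqrt_div_sq_add_sq hy]
    have := Real.pi_pos
    field_simp
  rw [h3] at h2
  push_cast at h2 ⊢
  rw [← two_mul] at h2
  linear_combination h2 / 2

/-- The semicircle distribution as a measure. -/
def semicircleMeasure : Measure ℝ :=
  volume.withDensity fun x => ENNReal.ofReal (semicircleDensity x)

instance : IsProbabilityMeasure semicircleMeasure := by
  refine ⟨?_⟩
  rw [semicircleMeasure, withDensity_apply _ MeasurableSet.univ, Measure.restrict_univ, ← ofReal_integral_eq_lintegral_ofReal integrable_semicircleDensity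
    (Eventually.of_forall semicircleDensity_nonneg), integral_semicircleDensity, ENNReal.ofReal_one]

theorem integral_semicircleMeasure {E : Type*} [NormedAddCommGroup E] [NormedSpace ℝ E]
    (g : ℝ → E) : ∫ x, g x ∂semicircleMeasure = ∫ x, semicircleDensity x • g x := by
  rw [semicircleMeasure, integral_withDensity_eq_integral_toReal_smul
    (continuous_semicircleDensity.measurable.ennreal_ofReal) (by simp)]
  simp only [ENNReal.toReal_ofReal (semicircleDensity_nonneg _)]

theorem semicircleMeasure_Iic (x : ℝ) :
    (semicircleMeasure (Set.Iic x)).toReal = semicircleDistribution x := by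
  rw [semicircleMeasure, withDensity_apply _ measurableSet_Iic, semicircleDistribution,
    ← ofReal_integral_eq_lintegral_ofReal integrable_semicircleDensity.integrableOn
      (Eventually.of_forall semicircleDensity_nonneg), ENNReal.toReal_ofReal]
  exact integral_nonneg semicircleDensity_nonneg

theorem semicircleMeasure_singleton (x : ℝ) : semicircleMeasure {x} = 0 :=
  withDensity_absolutelyContinuous _ _ (measure_singleton x)

end Semicircle

/-! ### Weak convergence from transforms on the imaginary axis -/

section WeakConvergence

open scoped BoundedContinuousFunction

theorem abs_le_norm_add_mul_I (y x : ℝ) : |y| ≤ ‖(y : ℂ) + x * Complex.I‖ := by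
  simpa using Complex.abs_re_le_norm ((y : ℂ) + x * Complex.I)

theorem norm_inv_add_mul_I_le {y : ℝ} (hy : y ≠ 0) (x : ℝ) :
    ‖((y : ℂ) + x * Complex.I)⁻¹‖ ≤ |y|⁻¹ := by
  rw [norm_inv]
  exact inv_anti₀ (abs_pos.2 hy) (abs_le_norm_add_mul_I y x)

/-- The function `x ↦ 1 / (y + i x)`. -/
def resolventKernel (y : {q : ℚ // q ≠ 0}) : ℝ →ᵇ ℂ :=
  BoundedContinuousFunction.ofNormedAddCommGroup
    (fun x : ℝ => (((y.1 : ℝ) : ℂ) + x * Complex.I)⁻¹)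
    (continuous_inv_add_mul_I (Rat.cast_ne_zero.2 y.2)) |(y.1 : ℝ)|⁻¹
    (norm_inv_add_mul_I_le (Rat.cast_ne_zero.2 y.2))

theorem resolventKernel_apply (y : {q : ℚ // q ≠ 0}) (x : ℝ) :
    resolventKernel y x = (((y.1 : ℝ) : ℂ) + x * Complex.I)⁻¹ := rfl

theorem resolventKernel_ne_zero (y : {q : ℚ // q ≠ 0}) (x : ℝ) :
    ((y.1 : ℝ) : ℂ) + x * Complex.I ≠ 0 :=
  add_mul_I_ne_zero (Rat.cast_ne_zero.2 y.2) x

/-- Read backwards, this makes a product of two kernels with distinct parameters a linear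
combination of kernels. -/
theorem resolventKernel_sub (y z : {q : ℚ // q ≠ 0}) :
    resolventKernel y - resolventKernel z
      = (((z.1 : ℝ) - (y.1 : ℝ) : ℝ) : ℂ) • (resolventKernel y * resolventKernel z) := by
  ext x
  have h1 := resolventKernel_ne_zero y x
  have h2 := resolventKernel_ne_zero z x
  simp only [BoundedContinuousFunction.coe_sub, Pi.sub_apply, BoundedContinuousFunction.coe_smul,
    BoundedContinuousFunction.coe_mul, Pi.mul_apply, resolventKernel_apply, smul_eq_mul]
  field_simp
  push_cast
  ring

/-- Closure under conjugation is the reason for admitting negative parameters. -/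
theorem star_resolventKernel (y : {q : ℚ // q ≠ 0}) :
    star (resolventKernel y) = -resolventKernel ⟨-y.1, neg_ne_zero.2 y.2⟩ := by
  ext x
  simp only [BoundedContinuousFunction.coe_star, Pi.star_apply, BoundedContinuousFunction.coe_neg,
    Pi.neg_apply, resolventKernel_apply, RCLike.star_def, map_inv₀, map_add, map_mul,
    Complex.conj_ofReal, Complex.conj_I, ← inv_neg]
  congr 1
  push_cast
  ring

/-- The closed linear span of the constants and the functions `x ↦ 1 / (y + i x)`. -/
def resolventSpan : Submodule ℂ (ℝ →ᵇ ℂ) :=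
  (Submodule.span ℂ ({1} ∪ Set.range resolventKernel)).topologicalClosure

theorem one_mem_resolventSpan : (1 : ℝ →ᵇ ℂ) ∈ resolventSpan :=
  Submodule.le_topologicalClosure _ (Submodule.subset_span (Or.inl rfl))

theorem resolventKernel_mem_resolventSpan (y : {q : ℚ // q ≠ 0}) :
    resolventKernel y ∈ resolventSpan :=
  Submodule.le_topologicalClosure _ (Submodule.subset_span (Or.inr ⟨y, rfl⟩))

theorem isClosed_resolventSpan : IsClosed (resolventSpan : Set (ℝ →ᵇ ℂ)) :=
  Submodule.isClosed_topologicalClosure _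

/-- A closed subspace which contains the constants and the functions `x ↦ 1 / (y + i x)` contains
their closed linear span. -/
theorem resolventSpan_le {W : Submodule ℂ (ℝ →ᵇ ℂ)} (hW : IsClosed (W : Set (ℝ →ᵇ ℂ)))
    (h1 : 1 ∈ W) (h2 : ∀ y, resolventKernel y ∈ W) : resolventSpan ≤ W := by
  refine Submodule.topologicalClosure_minimal _ (Submodule.span_le.2 ?_) hW
  rintro g (rfl | ⟨y, rfl⟩)
  · exact h1
  · exact h2 y

theorem resolventKernel_mul_of_ne {y z : {q : ℚ // q ≠ 0}} (h : y ≠ z) :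
    resolventKernel y * resolventKernel z ∈ resolventSpan := by
  have h1 : (((z.1 : ℝ) - (y.1 : ℝ) : ℝ) : ℂ) ≠ 0 := by
    rw [Complex.ofReal_ne_zero, sub_ne_zero]
    exact fun h2 => h (Subtype.ext (by exact_mod_cast h2.symm))
  have h3 := resolventKernel_sub y z
  rw [← inv_smul_eq_iff₀ h1] at h3
  rw [← h3]
  exact Submodule.smul_mem _ _ (Submodule.sub_mem _ (resolventKernel_mem_resolventSpan y)
    (resolventKernel_mem_resolventSpan z))

/-- Needed for the square of a kernel, which the resolvent identity does not reach directly. -/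
theorem tendsto_resolventKernel (y : {q : ℚ // q ≠ 0}) :
    ∃ z : ℕ → {q : ℚ // q ≠ 0}, (∀ k, z k ≠ y) ∧
      Tendsto (fun k => resolventKernel (z k)) atTop (𝓝 (resolventKernel y)) := by
  have hpos : ∀ k : ℕ, (0 : ℚ) < 1 / ((k : ℚ) + 1) := fun k => by positivity
  -- Moving the parameter away from 0 keeps every kernel bounded by 1/|y|.
  refine ⟨fun k => ⟨y.1 * (1 + 1 / ((k : ℚ) + 1)),
    mul_ne_zero y.2 (by have := hpos k; positivity)⟩, fun k h => ?_, ?_⟩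
  · have h1 : y.1 * (1 + 1 / ((k : ℚ) + 1)) = y.1 * 1 := by
      rw [mul_one]; exact congrArg Subtype.val h
    have := mul_left_cancel₀ y.2 h1
    linarith [hpos k]
  · rw [tendsto_iff_norm_sub_tendsto_zero]
    have hy : (0 : ℝ) < |(y.1 : ℝ)| := abs_pos.2 (Rat.cast_ne_zero.2 y.2)
    refine squeeze_zero (g := fun k : ℕ => 1 / ((k : ℝ) + 1) * |(y.1 : ℝ)|⁻¹)
      (fun k => norm_nonneg _) (fun k => ?_) ?_
    · set z : {q : ℚ // q ≠ 0} := ⟨y.1 * (1 + 1 / ((k : ℚ) + 1)),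
        mul_ne_zero y.2 (by have := hpos k; positivity)⟩ with hz
      have hk : (0 : ℝ) < 1 / ((k : ℝ) + 1) := by positivity
      have hzc : (z.1 : ℝ) = y.1 * (1 + 1 / ((k : ℝ) + 1)) := by
        rw [hz]; push_cast; ring
      have hyz : |(y.1 : ℝ)| ≤ |(z.1 : ℝ)| := by
        rw [hzc, abs_mul, abs_of_pos (by positivity : (0 : ℝ) < 1 + 1 / ((k : ℝ) + 1))]
        nlinarith
      have hn : ∀ q : {q : ℚ // q ≠ 0}, ‖resolventKernel q‖ ≤ |(q.1 : ℝ)|⁻¹ := fun q =>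
        BoundedContinuousFunction.norm_ofNormedAddCommGroup_le _ (by positivity) _
      rw [resolventKernel_sub, norm_smul, Complex.norm_real, Real.norm_eq_abs]
      calc _ ≤ |(y.1 : ℝ) - z.1| * (|(y.1 : ℝ)|⁻¹ * |(y.1 : ℝ)|⁻¹) := by
            gcongr
            refine (norm_mul_le _ _).trans ?_
            gcongr
            · exact (hn z).trans (inv_anti₀ hy hyz)
            · exact hn y
        _ = 1 / ((k : ℝ) + 1) * |(y.1 : ℝ)|⁻¹ := by
            rw [hzc, show (y.1 : ℝ) - y.1 * (1 + 1 / ((k : ℝ) + 1)) = -(y.1 * (1 / ((k : ℝ) + 1)))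
              by ring, abs_neg, abs_mul, abs_of_pos hk]
            field_simp
    · simpa using tendsto_one_div_add_atTop_nhds_zero_nat.mul_const (|(y.1 : ℝ)|⁻¹)

theorem resolventKernel_mul (y z : {q : ℚ // q ≠ 0}) :
    resolventKernel y * resolventKernel z ∈ resolventSpan := by
  by_cases h : y = z
  · subst h
    obtain ⟨z, hz, hlim⟩ := tendsto_resolventKernel y
    exact isClosed_resolventSpan.mem_of_tendsto (hlim.mul_const (resolventKernel y))
      (Eventually.of_forall fun k => resolventKernel_mul_of_ne (hz k))
  · exact resolventKernel_mul_of_ne h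

/-- Extension from generators in two passes: first one factor is a fixed kernel, then it is an
arbitrary element of the span. -/
theorem mul_mem_resolventSpan {f g : ℝ →ᵇ ℂ} (hf : f ∈ resolventSpan) (hg : g ∈ resolventSpan) :
    f * g ∈ resolventSpan := by
  have comap_closed : ∀ h : ℝ →ᵇ ℂ, IsClosed
      ((resolventSpan.comap (LinearMap.mulLeft ℂ h) : Submodule ℂ (ℝ →ᵇ ℂ)) : Set (ℝ →ᵇ ℂ)) :=
    fun h => isClosed_resolventSpan.preimage (continuous_const_mul h)
  have h1 : ∀ y, resolventSpan ≤ resolventSpan.comap (LinearMap.mulLeft ℂ (resolventKernel y)) := by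
    intro y
    refine resolventSpan_le (comap_closed _) ?_ fun z => resolventKernel_mul y z
    change resolventKernel y * 1 ∈ resolventSpan
    rw [mul_one]
    exact resolventKernel_mem_resolventSpan y
  have h2 : resolventSpan ≤ resolventSpan.comap (LinearMap.mulLeft ℂ g) := by
    refine resolventSpan_le (comap_closed _) ?_ fun y => ?_
    · change g * 1 ∈ resolventSpan
      rwa [mul_one]
    · change g * resolventKernel y ∈ resolventSpan
      rw [mul_comm]
      exact h1 y hg
  rw [mul_comm]
  exact h2 hf

theorem star_mem_resolventSpan {f : ℝ →ᵇ ℂ} (hf : f ∈ resolventSpan) : star f ∈ resolventSpan := by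
  let W : Submodule ℂ (ℝ →ᵇ ℂ) :=
    { carrier := {f | star f ∈ resolventSpan}
      add_mem' := fun {f g} hf hg => by
        simp only [Set.mem_ofPred_eq, star_add]
        exact Submodule.add_mem _ hf hg
      zero_mem' := by simp
      smul_mem' := fun c f hf => by
        simp only [Set.mem_ofPred_eq, star_smul]
        exact Submodule.smul_mem _ _ hf }
  have hW : resolventSpan ≤ W := by
    refine resolventSpan_le (isClosed_resolventSpan.preimage continuous_star) ?_ fun y => ?_
    · change star 1 ∈ resolventSpan
      rw [star_one]
      exact one_mem_resolventSpan
    · change star (resolventKernel y) ∈ resolventSpan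
      rw [star_resolventKernel]
      exact Submodule.neg_mem _ (resolventKernel_mem_resolventSpan _)
  exact hW hf

/-- The closed linear span of the functions `x ↦ 1 / (y + i x)` and the constants, as a
star subalgebra. -/
def resolventAlgebra : StarSubalgebra ℂ (ℝ →ᵇ ℂ) where
  carrier := resolventSpan
  mul_mem' := mul_mem_resolventSpan
  add_mem' := Submodule.add_mem _
  algebraMap_mem' r := by
    rw [Algebra.algebraMap_eq_smul_one]
    exact Submodule.smul_mem _ _ one_mem_resolventSpan
  star_mem' := star_mem_resolventSpan

theorem resolventAlgebra_separatesPoints :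
    (resolventAlgebra.map (BoundedContinuousFunction.toContinuousMapStarₐ ℂ)).SeparatesPoints := by
  intro x x' hx
  refine ⟨_, ⟨_, ⟨resolventKernel ⟨1, one_ne_zero⟩,
    resolventKernel_mem_resolventSpan _, rfl⟩, rfl⟩, fun h => hx ?_⟩
  change resolventKernel _ x = resolventKernel _ x' at h
  rw [resolventKernel_apply, resolventKernel_apply, inv_inj] at h
  have := congrArg Complex.im h
  simpa using this

/-- Integration against a probability measure is 1-Lipschitz in the sup norm, uniformly in the
measure; an ε/3 argument follows. -/
theorem isClosed_setOf_tendsto_integral (μ : ℕ → ProbabilityMeasure ℝ) (μ₀ : ProbabilityMeasure ℝ) :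
    IsClosed {g : ℝ →ᵇ ℂ | Tendsto (fun n => ∫ x, g x ∂(μ n : Measure ℝ)) atTop
      (𝓝 (∫ x, g x ∂(μ₀ : Measure ℝ)))} := by
  rw [← isSeqClosed_iff_isClosed]
  intro u g hu hlim
  have hb : ∀ (ν : ProbabilityMeasure ℝ) (k : ℕ),
      dist (∫ x, g x ∂(ν : Measure ℝ)) (∫ x, u k x ∂(ν : Measure ℝ)) ≤ dist g (u k) := by
    intro ν k
    rw [dist_eq_norm, dist_eq_norm, ← integral_sub (BoundedContinuousFunction.integrable _ g)
      (BoundedContinuousFunction.integrable _ (u k))]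
    refine (norm_integral_le_of_norm_le_const (C := ‖g - u k‖)
      (Eventually.of_forall fun x => ?_)).trans (by simp)
    exact BoundedContinuousFunction.norm_coe_le_norm (g - u k) x
  rw [Set.mem_ofPred_eq, Metric.tendsto_atTop]
  intro ε hε
  obtain ⟨k, hk⟩ := ((tendsto_iff_dist_tendsto_zero.1 hlim).eventually_lt_const
    (by positivity : (0 : ℝ) < ε / 3)).exists
  rw [dist_comm] at hk
  obtain ⟨N, hN⟩ := Metric.tendsto_atTop.1 (hu k) (ε / 3) (by positivity)
  refine ⟨N, fun n hn => ?_⟩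
  have h1 := hb (μ n) k
  have h2 := hb μ₀ k
  rw [dist_comm] at h2
  have h3 := hN n hn
  have h4 := dist_triangle4 (∫ x, g x ∂(μ n : Measure ℝ)) (∫ x, u k x ∂(μ n : Measure ℝ))
    (∫ x, u k x ∂(μ₀ : Measure ℝ)) (∫ x, g x ∂(μ₀ : Measure ℝ))
  linarith

theorem tendsto_integral_of_mem_resolventSpan {μ : ℕ → ProbabilityMeasure ℝ}
    {μ₀ : ProbabilityMeasure ℝ}
    (h : ∀ y, Tendsto (fun n => ∫ x, resolventKernel y x ∂(μ n : Measure ℝ)) atTop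
      (𝓝 (∫ x, resolventKernel y x ∂(μ₀ : Measure ℝ))))
    {g : ℝ →ᵇ ℂ} (hg : g ∈ resolventSpan) :
    Tendsto (fun n => ∫ x, g x ∂(μ n : Measure ℝ)) atTop (𝓝 (∫ x, g x ∂(μ₀ : Measure ℝ))) := by
  let W : Submodule ℂ (ℝ →ᵇ ℂ) :=
    { carrier := {g : ℝ →ᵇ ℂ | Tendsto (fun n => ∫ x, g x ∂(μ n : Measure ℝ)) atTop
        (𝓝 (∫ x, g x ∂(μ₀ : Measure ℝ)))}
      add_mem' := fun {f g} hf hg => by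
        simp only [Set.mem_ofPred_eq, BoundedContinuousFunction.coe_add, Pi.add_apply] at hf hg ⊢
        simp only [integral_add (BoundedContinuousFunction.integrable _ f)
          (BoundedContinuousFunction.integrable _ g)]
        exact hf.add hg
      zero_mem' := by simp
      smul_mem' := fun c f hf => by
        simp only [Set.mem_ofPred_eq, BoundedContinuousFunction.coe_smul, integral_smul] at hf ⊢
        exact hf.const_smul c }
  have hW : resolventSpan ≤ W :=
    resolventSpan_le (isClosed_setOf_tendsto_integral μ μ₀) (by
      change Tendsto (fun n => ∫ x, (1 : ℝ →ᵇ ℂ) x ∂(μ n : Measure ℝ)) atTop _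
      simp) h
  exact hW hg

/-- The integrand 1 - k Re 1/(k + ix) = x²/(k² + x²) is nonnegative, and at least 1/2 once |x| ≥ k.
-/
theorem measure_lt_norm_le (ν : ProbabilityMeasure ℝ) {k : {q : ℚ // q ≠ 0}} (hk : 0 < k.1)
    {r : ℝ} (hr : (k.1 : ℝ) ≤ r) :
    (ν : Measure ℝ) {x | r < ‖x‖} ≤ ENNReal.ofReal
      (2 * (1 - k.1 * (∫ x, resolventKernel k x ∂(ν : Measure ℝ)).re)) := by
  have hk' : (0 : ℝ) < k.1 := by exact_mod_cast hk
  have hre : ∀ x : ℝ, (resolventKernel k x).re = k.1 / (k.1 ^ 2 + x ^ 2) := by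
    intro x
    rw [resolventKernel_apply, Complex.inv_re]
    simp [Complex.normSq_apply, pow_two]
  have hint : Integrable (fun x => (resolventKernel k x).re) (ν : Measure ℝ) :=
    (BoundedContinuousFunction.integrable (ν : Measure ℝ) (resolventKernel k)).re
  have hI : (∫ x, resolventKernel k x ∂(ν : Measure ℝ)).re
      = ∫ x, (resolventKernel k x).re ∂(ν : Measure ℝ) :=
    (integral_re (𝕜 := ℂ) (BoundedContinuousFunction.integrable (ν : Measure ℝ)
      (resolventKernel k))).symm
  have hg : Integrable (fun x => 2 * (1 - k.1 * (resolventKernel k x).re)) (ν : Measure ℝ) :=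
    ((integrable_const 1).sub (hint.const_mul _)).const_mul _
  have hnn : ∀ x : ℝ, 0 ≤ 2 * (1 - k.1 * (resolventKernel k x).re) := by
    intro x
    rw [hre, ← mul_div_assoc]
    have : (k.1 : ℝ) * k.1 / (k.1 ^ 2 + x ^ 2) ≤ 1 := by
      rw [div_le_one (by positivity)]
      nlinarith [sq_nonneg x]
    linarith
  have h1 : 2 * (1 - k.1 * (∫ x, resolventKernel k x ∂(ν : Measure ℝ)).re)
      = ∫ x, 2 * (1 - k.1 * (resolventKernel k x).re) ∂(ν : Measure ℝ) := by
    rw [integral_const_mul, integral_sub (integrable_const 1) (hint.const_mul _),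
      integral_const_mul, hI]
    simp
  rw [h1, ofReal_integral_eq_lintegral_ofReal hg (Eventually.of_forall hnn)]
  have hms : MeasurableSet {x : ℝ | r < ‖x‖} := measurableSet_lt measurable_const measurable_norm
  rw [← lintegral_indicator_one hms]
  refine lintegral_mono fun x => ?_
  by_cases hx : x ∈ {x : ℝ | r < ‖x‖}
  · rw [Set.indicator_of_mem hx, Pi.one_apply, ← ENNReal.ofReal_one]
    refine ENNReal.ofReal_le_ofReal ?_
    rw [hre, ← mul_div_assoc]
    have h2 : (k.1 : ℝ) ≤ |x| := hr.trans (le_of_lt hx)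
    have h3 : (k.1 : ℝ) ^ 2 ≤ x ^ 2 := by rw [← sq_abs x]; gcongr
    have : (k.1 : ℝ) * k.1 / (k.1 ^ 2 + x ^ 2) ≤ 1 / 2 := by
      rw [div_le_div_iff₀ (by positivity) two_pos]
      nlinarith
    linarith
  · rw [Set.indicator_of_notMem hx]
    exact zero_le

/-- Dominated convergence: k/(k + ix) = 1/(1 + ix/k) has modulus at most 1 and tends to 1. -/
theorem tendsto_mul_integral_resolventKernel (ν : ProbabilityMeasure ℝ) :
    Tendsto (fun k : ℕ => 2 * (1 - ((k : ℝ) + 1) *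
      (∫ x, resolventKernel ⟨(k : ℚ) + 1, by positivity⟩ x ∂(ν : Measure ℝ)).re)) atTop (𝓝 0) := by
  have h1 : Tendsto (fun k : ℕ => ∫ x, (((k : ℝ) + 1 : ℝ) : ℂ) *
      resolventKernel ⟨(k : ℚ) + 1, by positivity⟩ x ∂(ν : Measure ℝ)) atTop
      (𝓝 (∫ _x, (1 : ℂ) ∂(ν : Measure ℝ))) := by
    refine tendsto_integral_of_dominated_convergence (fun _ => 1) (fun k => ?_)
      (integrable_const 1) (fun k => Eventually.of_forall fun x => ?_)
      (Eventually.of_forall fun x => ?_)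
    · exact ((resolventKernel _).continuous.const_mul _).aestronglyMeasurable
    · have hk : (0 : ℝ) < (k : ℝ) + 1 := by positivity
      rw [norm_mul, Complex.norm_real, Real.norm_eq_abs, abs_of_pos hk]
      have h2 := norm_inv_add_mul_I_le hk.ne' x
      rw [abs_of_pos hk] at h2
      calc _ ≤ ((k : ℝ) + 1) * ((k : ℝ) + 1)⁻¹ := by
            gcongr
            rw [resolventKernel_apply]
            simpa using h2
        _ = 1 := mul_inv_cancel₀ hk.ne'
    · have h3 : ∀ k : ℕ, (((k : ℝ) + 1 : ℝ) : ℂ) * resolventKernel ⟨(k : ℚ) + 1, by positivity⟩ x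
          = (1 + ((1 / ((k : ℝ) + 1) * x : ℝ) : ℂ) * Complex.I)⁻¹ := by
        intro k
        have hk : ((k : ℂ) + 1) ≠ 0 := by exact_mod_cast Nat.succ_ne_zero k
        rw [resolventKernel_apply]
        push_cast
        rw [← div_eq_mul_inv, ← inv_div]
        congr 1
        field_simp
      simp only [h3]
      have h4 : Tendsto (fun k : ℕ => (1 + ((1 / ((k : ℝ) + 1) * x : ℝ) : ℂ) * Complex.I)⁻¹) atTop
          (𝓝 ((1 + ((0 * x : ℝ) : ℂ) * Complex.I)⁻¹)) := by
        refine Tendsto.inv₀ ?_ (by simp)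
        refine tendsto_const_nhds.add (Tendsto.mul_const _ ?_)
        exact (Complex.continuous_ofReal.tendsto _).comp
          (tendsto_one_div_add_atTop_nhds_zero_nat.mul_const x)
      simpa using h4
  have h5 := (Complex.continuous_re.tendsto _).comp h1
  have h6 := (h5.const_sub 1).const_mul 2
  simp only [Function.comp_def, integral_const_mul, Complex.re_ofReal_mul] at h6
  simpa using h6

/-- Pointwise convergence of the transforms `∫ 1 / (y + i x) dμ` implies weak convergence. -/
theorem tendsto_of_tendsto_integral_resolventKernel {μ : ℕ → ProbabilityMeasure ℝ}
    {μ₀ : ProbabilityMeasure ℝ}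
    (h : ∀ y, Tendsto (fun n => ∫ x, resolventKernel y x ∂(μ n : Measure ℝ)) atTop
      (𝓝 (∫ x, resolventKernel y x ∂(μ₀ : Measure ℝ)))) :
    Tendsto μ atTop (𝓝 μ₀) := by
  refine ProbabilityMeasure.tendsto_of_tight_of_separatesPoints ℂ ?_
    resolventAlgebra_separatesPoints fun g hg => tendsto_integral_of_mem_resolventSpan h hg
  -- Separating points determines the limit only for a tight sequence. The tail bound passes to the
  -- limit in n through the transforms, so the tails are controlled by μ₀ alone.
  refine isTightMeasureSet_range_of_tendsto_limsup_measure_norm_gt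
    (μ := fun n => (μ n : Measure ℝ)) ?_
  have h1 := (ENNReal.continuous_ofReal.tendsto _).comp (tendsto_mul_integral_resolventKernel μ₀)
  rw [ENNReal.ofReal_zero] at h1
  -- The kernel parameter is k + 1, which then equals ⌊r⌋₊ ≤ r.
  have h2 : Tendsto (fun r : ℝ => ⌊r⌋₊ - 1) atTop atTop :=
    (tendsto_sub_atTop_nat 1).comp tendsto_nat_floor_atTop
  refine tendsto_of_tendsto_of_tendsto_of_le_of_le' tendsto_const_nhds (h1.comp h2)
    (Eventually.of_forall fun r => zero_le) ?_
  filter_upwards [eventually_ge_atTop 1] with r hr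
  have hfl : 1 ≤ ⌊r⌋₊ := Nat.one_le_floor_iff r |>.2 hr
  set k := ⌊r⌋₊ - 1 with hk
  have hkr : (k : ℝ) + 1 ≤ r := by
    have h3 : k + 1 = ⌊r⌋₊ := by omega
    have h4 : ((k + 1 : ℕ) : ℝ) ≤ r := by
      rw [h3]; exact Nat.floor_le (by linarith)
    exact_mod_cast h4
  have h5 : Tendsto (fun n => ENNReal.ofReal (2 * (1 - ((k : ℝ) + 1) *
      (∫ x, resolventKernel ⟨(k : ℚ) + 1, by positivity⟩ x ∂(μ n : Measure ℝ)).re))) atTop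
      (𝓝 (ENNReal.ofReal (2 * (1 - ((k : ℝ) + 1) *
      (∫ x, resolventKernel ⟨(k : ℚ) + 1, by positivity⟩ x ∂(μ₀ : Measure ℝ)).re)))) := by
    refine (ENNReal.continuous_ofReal.tendsto _).comp ?_
    exact ((((Complex.continuous_re.tendsto _).comp (h _)).const_mul _).const_sub 1).const_mul 2
  simp only [Function.comp_apply]
  rw [← h5.limsup_eq]
  refine limsup_le_limsup (Eventually.of_forall fun n => ?_)
  have h6 := measure_lt_norm_le (μ n) (k := ⟨(k : ℚ) + 1, by positivity⟩)
    (show (0 : ℚ) < k + 1 by positivity) (r := r) (by push_cast; exact hkr)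
  push_cast at h6
  exact h6

end WeakConvergence

/-! ### Empirical spectral measures and their transforms -/

section EmpiricalMeasure

variable {n : ℕ} {H : Matrix (Fin n) (Fin n) ℂ}

/-- The trace of the resolvent of a Hermitian matrix in terms of its eigenvalues. -/
theorem trace_inv_smul_one_add (hH : H.IsHermitian) {y : ℝ} (hy : y ≠ 0) :
    (((y : ℂ) • (1 : Matrix (Fin n) (Fin n) ℂ) + Complex.I • H)⁻¹).trace
      = ∑ i, ((y : ℂ) + hH.eigenvalues i * Complex.I)⁻¹ := by
  set U : Matrix (Fin n) (Fin n) ℂ := (hH.eigenvectorUnitary : Matrix (Fin n) (Fin n) ℂ) with hU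
  have hU1 : star U * U = 1 := Unitary.coe_star_mul_self hH.eigenvectorUnitary
  have hU2 : U * star U = 1 := Unitary.coe_mul_star_self hH.eigenvectorUnitary
  have hspec : H = U * Matrix.diagonal (fun i => (hH.eigenvalues i : ℂ)) * star U := by
    conv_lhs => rw [hH.spectral_theorem]
    rfl
  set d : Fin n → ℂ := fun i => (y : ℂ) + hH.eigenvalues i * Complex.I with hd
  have hM : (y : ℂ) • (1 : Matrix (Fin n) (Fin n) ℂ) + Complex.I • H
      = U * Matrix.diagonal d * star U := by
    have h1 : Matrix.diagonal d = (y : ℂ) • (1 : Matrix (Fin n) (Fin n) ℂ)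
        + Complex.I • Matrix.diagonal (fun i => (hH.eigenvalues i : ℂ)) := by
      ext i j
      by_cases hij : i = j
      · subst hij; simp [hd, mul_comm]
      · simp [hij]
    rw [h1, mul_add, add_mul, Matrix.mul_smul, Matrix.mul_smul, Matrix.smul_mul, Matrix.smul_mul,
      mul_one, hU2, ← hspec]
  have hinv : (U * Matrix.diagonal d * star U) * (U * Matrix.diagonal d⁻¹ * star U) = 1 := by
    calc _ = U * (Matrix.diagonal d * (star U * U) * Matrix.diagonal d⁻¹) * star U := by
          simp only [mul_assoc]
      _ = 1 := by
          rw [hU1, mul_one, Matrix.diagonal_mul_diagonal]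
          have h2 : (fun i => d i * d⁻¹ i) = fun _ => 1 :=
            funext fun i => mul_inv_cancel₀ (add_mul_I_ne_zero hy _)
          rw [h2, Matrix.diagonal_one, mul_one, hU2]
  rw [hM, Matrix.inv_eq_right_inv hinv, Matrix.trace_mul_comm, ← mul_assoc, hU1, one_mul,
    Matrix.trace_diagonal]
  rfl

/-- The empirical distribution of the eigenvalues as a measure. -/
def empiricalSpectralMeasure (hH : H.IsHermitian) : Measure ℝ :=
  (n : ENNReal)⁻¹ • ∑ i, Measure.dirac (hH.eigenvalues i)

theorem isProbabilityMeasure_empiricalSpectralMeasure (hn : n ≠ 0) (hH : H.IsHermitian) :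
    IsProbabilityMeasure (empiricalSpectralMeasure hH) := by
  refine ⟨?_⟩
  rw [empiricalSpectralMeasure, Measure.smul_apply, Measure.finsetSum_apply]
  simp only [measure_univ, Finset.sum_const, Finset.card_univ, Fintype.card_fin, nsmul_eq_mul,
    mul_one, smul_eq_mul]
  exact ENNReal.inv_mul_cancel (by exact_mod_cast hn) (ENNReal.natCast_ne_top n)

theorem empiricalSpectralMeasure_Iic (hH : H.IsHermitian) (x : ℝ) :
    (empiricalSpectralMeasure hH (Set.Iic x)).toReal = empiricalSpectralDistribution hH x := by
  rw [empiricalSpectralMeasure, Measure.smul_apply, Measure.finsetSum_apply,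
    empiricalSpectralDistribution]
  simp only [Measure.dirac_apply' _ measurableSet_Iic, Set.indicator_apply, Set.mem_Iic,
    Pi.one_apply, smul_eq_mul, ENNReal.toReal_mul, ENNReal.toReal_inv, ENNReal.toReal_natCast,
    Finset.sum_boole, one_div]

theorem integral_empiricalSpectralMeasure (hH : H.IsHermitian) {g : ℝ → ℂ} :
    ∫ x, g x ∂(empiricalSpectralMeasure hH) = (1 / (n : ℂ)) * ∑ i, g (hH.eigenvalues i) := by
  rw [empiricalSpectralMeasure, integral_smul_measure, integral_finsetSum_measure]
  · simp
  · intro i _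
    exact integrable_dirac (by simp)

/-- Since iH is the real matrix A, the resolvent of H on the imaginary axis is the complexification
of a real one. -/
theorem integral_inv_empiricalSpectralMeasure (hH : H.IsHermitian) {A : Matrix (Fin n) (Fin n) ℝ}
    (hA : A.transpose = -A) (hHA : Complex.I • H = A.map (fun s : ℝ => (s : ℂ))) {y : ℝ}
    (hy : 0 < y) :
    ∫ x : ℝ, ((y : ℂ) + x * Complex.I)⁻¹ ∂(empiricalSpectralMeasure hH)
      = ((1 / (n : ℝ) * (skewResolvent y A).trace : ℝ) : ℂ) := by
  rw [integral_empiricalSpectralMeasure, ← trace_inv_smul_one_add hH hy.ne', hHA]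
  have h1 : ((y : ℂ) • (1 : Matrix (Fin n) (Fin n) ℂ) + A.map (fun s : ℝ => (s : ℂ)))
      = Complex.ofRealHom.mapMatrix (y • (1 : Matrix (Fin n) (Fin n) ℝ) + A) := by
    ext i j
    by_cases hij : i = j
    · subst hij; simp
    · simp [hij]
  have h2 : ((y : ℂ) • (1 : Matrix (Fin n) (Fin n) ℂ) + A.map (fun s : ℝ => (s : ℂ)))⁻¹
      = Complex.ofRealHom.mapMatrix (skewResolvent y A) := by
    refine Matrix.inv_eq_right_inv ?_
    rw [h1, ← map_mul, mul_skewResolvent hy hA, map_one]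
  rw [h2]
  simp [Matrix.trace]

/-- Convergence of the empirical spectral distributions follows from the convergence of the
normalized traces of the resolvents on the imaginary axis. -/
theorem convergesInDistribution_semicircle
    (H : (n : ℕ) → Matrix (Fin n) (Fin n) ℂ) (hH : ∀ n, (H n).IsHermitian)
    (A : (n : ℕ) → Matrix (Fin n) (Fin n) ℝ) (hA : ∀ n, (A n).transpose = -A n)
    (hHA : ∀ n, Complex.I • H n = (A n).map (fun s : ℝ => (s : ℂ)))
    (h : ∀ y : ℚ, 0 < y → Tendsto (fun n : ℕ => 1 / (n : ℝ) * (skewResolvent (y : ℝ) (A n)).trace)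
      atTop (𝓝 ((Real.sqrt (4 + (y : ℝ) ^ 2) - y) / 2))) :
    ConvergesInDistribution (fun n => empiricalSpectralDistribution (hH n))
      semicircleDistribution := by
  intro x _
  -- At order 0 the empirical measure is zero, not a probability measure, so the sequence starts at
  -- order 1.
  rw [← tendsto_add_atTop_iff_nat 1]
  set μ : ℕ → ProbabilityMeasure ℝ := fun n => ⟨empiricalSpectralMeasure (hH (n + 1)),
    isProbabilityMeasure_empiricalSpectralMeasure n.succ_ne_zero _⟩ with hμ
  set μ₀ : ProbabilityMeasure ℝ := ⟨semicircleMeasure, inferInstance⟩ with hμ₀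
  have hpos : ∀ y : {q : ℚ // q ≠ 0}, 0 < y.1 →
      Tendsto (fun n => ∫ x, resolventKernel y x ∂(μ n : Measure ℝ)) atTop
        (𝓝 (∫ x, resolventKernel y x ∂(μ₀ : Measure ℝ))) := by
    intro y hy
    have hy' : (0 : ℝ) < (y.1 : ℝ) := by exact_mod_cast hy
    have h1 : ∀ n, ∫ x, resolventKernel y x ∂(μ n : Measure ℝ) = ((1 / ((n + 1 : ℕ) : ℝ) *
        (skewResolvent (y.1 : ℝ) (A (n + 1))).trace : ℝ) : ℂ) := fun n =>
      integral_inv_empiricalSpectralMeasure (hH (n + 1)) (hA _) (hHA _) hy'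
    have h2 : ∫ x, resolventKernel y x ∂(μ₀ : Measure ℝ)
        = (((Real.sqrt (4 + (y.1 : ℝ) ^ 2) - y.1) / 2 : ℝ) : ℂ) :=
      (integral_semicircleMeasure _).trans (integral_semicircleDensity_smul_inv hy')
    simp only [h1, h2]
    exact (Complex.continuous_ofReal.tendsto _).comp ((tendsto_add_atTop_iff_nat 1).2 (h y.1 hy))
  -- Conjugation carries convergence from positive parameters to negative ones.
  have hstar : ∀ (ν : ProbabilityMeasure ℝ) (y : {q : ℚ // q ≠ 0}),
      ∫ x, resolventKernel y x ∂(ν : Measure ℝ) = -(starRingEnd ℂ) (∫ x,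
        resolventKernel ⟨-y.1, neg_ne_zero.2 y.2⟩ x ∂(ν : Measure ℝ)) := by
    intro ν y
    rw [← integral_conj, ← integral_neg]
    refine integral_congr_ae (Eventually.of_forall fun x => ?_)
    have h3 := congrArg (fun g : BoundedContinuousFunction ℝ ℂ => g x)
      (star_resolventKernel ⟨-y.1, neg_ne_zero.2 y.2⟩)
    simp only [neg_neg] at h3
    exact (neg_eq_iff_eq_neg.2 h3).symm
  have hlim : Tendsto μ atTop (𝓝 μ₀) := by
    refine tendsto_of_tendsto_integral_resolventKernel fun y => ?_
    rcases lt_or_gt_of_ne y.2 with hy | hy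
    · simp only [hstar _ y]
      exact ((Complex.continuous_conj.tendsto _).comp
        (hpos ⟨-y.1, neg_ne_zero.2 y.2⟩ (neg_pos.2 hy))).neg
    · exact hpos y hy
  -- Portmanteau: the frontier of the half-line is {x}, which has no semicircle mass.
  have h4 := ProbabilityMeasure.tendsto_measure_of_null_frontier_of_tendsto' hlim
    (E := Set.Iic x) (by rw [frontier_Iic]; exact semicircleMeasure_singleton x)
  have h5 := (ENNReal.tendsto_toReal (measure_ne_top _ _)).comp h4
  rw [← semicircleMeasure_Iic]
  refine h5.congr fun n => ?_
  exact empiricalSpectralMeasure_Iic (hH (n + 1)) x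

end EmpiricalMeasure

/-! ### Random oriented graphs: concentration, limit of the mean, almost sure convergence -/

section RandomOrientedGraph

open OrientedGraph

/-- The entry of the skew-adjacency matrix determined by the two coins of a pair. -/
def coinSign (x : Bool × Bool) : ℝ := if x.1 then (if x.2 then 1 else -1) else 0

/-- The probability of the outcome `x` of the two coins of a pair. -/
def coinWeight (p : I) (x : Bool × Bool) : ℝ :=
  ((bernoulliMeasure true false p).prod (bernoulliMeasure true false fairCoin)).real {x}

/-- The value of an entry of the scaled skew-adjacency matrix. -/
def scaledSign (n : ℕ) (p : I) (x : Bool × Bool) : ℝ := 1 / Real.sqrt (n * p) * coinSign x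

theorem coinWeight_eq (p : I) (x : Bool × Bool) :
    coinWeight p x = (if x.1 then (p : ℝ) else 1 - p) * (1 / 2) := by
  obtain ⟨b, b'⟩ := x
  rw [coinWeight, ← Set.singleton_prod_singleton, measureReal_prod_prod]
  have h1 : ∀ (q : I) (b : Bool),
      (bernoulliMeasure true false q).real {b} = if b then (q : ℝ) else 1 - q := by
    intro q b
    rw [bernoulliMeasure_real_apply _ (MeasurableSet.singleton b)]
    cases b <;> simp
  rw [h1, h1]
  congr 1
  cases b' <;> norm_num [fairCoin]

theorem coinWeight_nonneg (p : I) (x : Bool × Bool) : 0 ≤ coinWeight p x := measureReal_nonneg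

theorem sum_coinWeight (p : I) : ∑ x, coinWeight p x = 1 := by
  simp only [coinWeight_eq, Fintype.sum_prod_type, Fintype.sum_bool]
  norm_num
  ring

theorem sum_coinWeight_mul_scaledSign (n : ℕ) (p : I) :
    ∑ x, coinWeight p x * scaledSign n p x = 0 := by
  simp only [coinWeight_eq, scaledSign, coinSign, Fintype.sum_prod_type, Fintype.sum_bool]
  norm_num

/-- An entry is nonzero with probability p and then has square 1/(np). -/
theorem sum_coinWeight_mul_scaledSign_sq {n : ℕ} {p : I} (hnp : 0 < (n : ℝ) * p) :
    ∑ x, coinWeight p x * scaledSign n p x ^ 2 = 1 / n := by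
  have hp : (p : ℝ) ≠ 0 := by rintro h; simp [h] at hnp
  have hn : (n : ℝ) ≠ 0 := by rintro h; simp [h] at hnp
  simp only [coinWeight_eq, scaledSign, coinSign, Fintype.sum_prod_type, Fintype.sum_bool, mul_pow,
    div_pow, Real.sq_sqrt hnp.le]
  norm_num
  field_simp
  norm_num

theorem scaledSign_false (n : ℕ) (p : I) : scaledSign n p (false, false) = 0 := by
  simp [scaledSign, coinSign]

theorem abs_scaledSign_le (n : ℕ) (p : I) (x : Bool × Bool) :
    |scaledSign n p x| ≤ 1 / Real.sqrt (n * p) := by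
  have h : |coinSign x| ≤ 1 := by
    obtain ⟨b, b'⟩ := x
    cases b <;> cases b' <;> simp [coinSign]
  have h0 : 0 ≤ 1 / Real.sqrt (n * p) := by positivity
  rw [scaledSign, abs_mul, abs_of_nonneg h0]
  exact mul_le_of_le_one_right h0 h

theorem skewAdjMatrix_ofCoins {n : ℕ} (c : VertexPair n → Bool × Bool) :
    (ofCoins c).skewAdjMatrix = skewOfPairs (coinSign ∘ c) := by
  classical
  ext u v
  simp only [skewAdjMatrix, Matrix.of_apply, ofCoins]
  rcases lt_trichotomy u v with h | rfl | h
  · rw [skewOfPairs_apply_of_lt _ h, Function.comp_apply]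
    simp only [h, h.not_gt, exists_true_left, IsEmpty.exists_iff, or_false, false_or]
    rcases hc : c ⟨(u, v), h⟩ with ⟨b, b'⟩
    cases b <;> cases b' <;> simp [coinSign]
  · simp [skewOfPairs_apply_self]
  · rw [skewOfPairs_apply_of_gt _ h, Function.comp_apply]
    simp only [h, h.not_gt, exists_true_left, IsEmpty.exists_iff, or_false, false_or]
    rcases hc : c ⟨(v, u), h⟩ with ⟨b, b'⟩
    cases b <;> cases b' <;> simp [coinSign]

theorem skewAdjMatrix_transpose {V : Type*} (G : OrientedGraph V) :
    G.skewAdjMatrix.transpose = -G.skewAdjMatrix := by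
  ext u v
  have := G.asymm u v
  by_cases h1 : G.Adj u v <;> by_cases h2 : G.Adj v u <;> simp_all [skewAdjMatrix]

/-- The normalized trace of the resolvent of the scaled skew-adjacency matrix. -/
def graphResolventMean {n : ℕ} (y : ℝ) (p : I) (G : OrientedGraph (Fin n)) : ℝ :=
  1 / (n : ℝ) * (skewResolvent y ((1 / Real.sqrt (n * p)) • G.skewAdjMatrix)).trace

theorem graphResolventMean_ofCoins {n : ℕ} (y : ℝ) (p : I) (c : VertexPair n → Bool × Bool) :
    graphResolventMean y p (ofCoins c) = resolventMean y (scaledSign n p) c := by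
  rw [graphResolventMean, resolventMean, skewAdjMatrix_ofCoins]
  congr 3
  ext u v
  rw [Matrix.smul_apply, smul_eq_mul]
  rcases lt_trichotomy u v with h | rfl | h
  · rw [skewOfPairs_apply_of_lt _ h, skewOfPairs_apply_of_lt _ h]
    rfl
  · rw [skewOfPairs_apply_self, skewOfPairs_apply_self, mul_zero]
  · rw [skewOfPairs_apply_of_gt _ h, skewOfPairs_apply_of_gt _ h, mul_neg]
    rfl

theorem I_smul_scaledMatrix {n : ℕ} (p : I) (G : OrientedGraph (Fin n)) :
    Complex.I • scaledMatrix p G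
      = ((1 / Real.sqrt (n * p)) • G.skewAdjMatrix).map (fun s : ℝ => (s : ℂ)) := by
  ext u v
  simp only [scaledMatrix, normalizedMatrix, Matrix.smul_apply, Matrix.map_apply, smul_eq_mul,
    Real.sqrt_mul (Nat.cast_nonneg n)]
  push_cast
  rw [one_div, one_div, one_div, mul_inv]
  linear_combination (-((Real.sqrt n : ℂ)⁻¹ * (Real.sqrt p : ℂ)⁻¹ * (G.skewAdjMatrix u v : ℂ)))
    * Complex.I_sq

/-- Passage from the graph measure to finite weighted sums over coins. -/
theorem randomModel_real_setOf {n : ℕ} (p : I) (B : Set (OrientedGraph (Fin n))) :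
    (randomModel n p).real B = productExpectation (coinWeight p)
      (fun c : VertexPair n → Bool × Bool => (ofCoins ⁻¹' B).indicator 1 c) := by
  rw [randomModel, map_measureReal_apply (measurable_of_finite _) MeasurableSpace.measurableSet_top,
    ← integral_indicator_one (Set.toFinite _).measurableSet, integral_fintype]
  · refine Finset.sum_congr rfl fun c _ => ?_
    rw [smul_eq_mul, measureReal_def, Measure.pi_singleton, ENNReal.toReal_prod]
    rfl
  · exact Integrable.of_finite

/-- Chernoff bound. -/
theorem randomModel_real_le_exp {n : ℕ} (p : I) (F : OrientedGraph (Fin n) → ℝ) (m ε l b : ℝ)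
    (hl : 0 ≤ l)
    (h : productExpectation (coinWeight p) (fun c : VertexPair n → Bool × Bool =>
      Real.exp (l * (F (ofCoins c) - m))) ≤ Real.exp b) :
    (randomModel n p).real {G | ε ≤ F G - m} ≤ Real.exp (b - l * ε) := by
  rw [randomModel_real_setOf]
  calc _ ≤ productExpectation (coinWeight p) (fun c : VertexPair n → Bool × Bool =>
        Real.exp (-(l * ε)) * Real.exp (l * (F (ofCoins c) - m))) := by
        refine productExpectation.mono (coinWeight_nonneg p) fun c => ?_
        by_cases hc : c ∈ ofCoins ⁻¹' {G | ε ≤ F G - m}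
        · rw [Set.indicator_of_mem hc, ← Real.exp_add, Pi.one_apply]
          refine Real.one_le_exp ?_
          have : l * ε ≤ l * (F (ofCoins c) - m) := mul_le_mul_of_nonneg_left hc hl
          linarith
        · rw [Set.indicator_of_notMem hc]
          positivity
    _ ≤ Real.exp (-(l * ε)) * Real.exp b := by
        rw [productExpectation.const_mul]
        gcongr
    _ = _ := by rw [← Real.exp_add]; congr 1; ring

/-- The mean of the normalized trace of the resolvent. -/
def meanResolvent (y : ℝ) (n : ℕ) (p : I) : ℝ :=
  productExpectation (coinWeight p) (resolventMean (n := n) y (scaledSign n p))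

theorem randomModel_real_deviation_le {n : ℕ} {p : I} (hnp : 0 < (n : ℝ) * p) {y ε : ℝ}
    (hy : 0 < y) (hε : 0 < ε) (ha : 1 / Real.sqrt (n * p) * (ε * y ^ 2 / 4) ≤ 1) :
    (randomModel n p).real {G | ε ≤ |graphResolventMean y p G - meanResolvent y n p|}
      ≤ 2 * Real.exp (-(ε ^ 2 * y ^ 4 / 16)) ^ n := by
  have hn0 : n ≠ 0 := by rintro rfl; simp at hnp
  have hn : 0 < n := Nat.pos_of_ne_zero hn0
  have hn' : (0 : ℝ) < n := by exact_mod_cast hn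
  -- This minimizes 4l²y⁻⁴/n - lε; the minimum is -nε²y⁴/16. With this l the smallness condition on
  -- increments is exactly `ha`.
  set l : ℝ := n * (ε * y ^ 4 / 8) with hl
  have hl0 : 0 ≤ l := by positivity
  have hmgf : ∀ l' : ℝ, |l'| = l → productExpectation (coinWeight p)
      (fun c : VertexPair n → Bool × Bool => Real.exp (l' *
        (graphResolventMean y p (ofCoins c) - meanResolvent y n p)))
      ≤ Real.exp (4 * l ^ 2 * (y⁻¹) ^ 4 / n) := by
    intro l' hl'
    simp only [graphResolventMean_ofCoins]
    rw [← hl', sq_abs]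
    refine productExpectation_exp_resolventMean_le hy hn (scaledSign_false n p)
      (coinWeight_nonneg p) (sum_coinWeight p) (sum_coinWeight_mul_scaledSign_sq hnp)
      (abs_scaledSign_le n p) l' ?_
    rw [hl', hl]
    refine le_trans (le_of_eq ?_) ha
    field_simp
    ring
  have hexp : Real.exp (4 * l ^ 2 * (y⁻¹) ^ 4 / n - l * ε)
      = Real.exp (-(ε ^ 2 * y ^ 4 / 16)) ^ n := by
    rw [← Real.exp_nat_mul]
    congr 1
    rw [hl]
    field_simp
    ring
  have h1 := randomModel_real_le_exp p (graphResolventMean y p) (meanResolvent y n p) ε l _ hl0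
    (hmgf l (abs_of_nonneg hl0))
  have h2 := randomModel_real_le_exp p (fun G => -graphResolventMean y p G) (-meanResolvent y n p)
    ε l (4 * l ^ 2 * (y⁻¹) ^ 4 / n) hl0 (by
      have h3 := hmgf (-l) (by rw [abs_neg, abs_of_nonneg hl0])
      refine le_trans (le_of_eq ?_) h3
      congr 1
      funext c
      congr 1
      ring)
  rw [hexp] at h1 h2
  have : IsFiniteMeasure (randomModel n p) := by
    rw [randomModel]; infer_instance
  calc _ ≤ (randomModel n p).real ({G | ε ≤ graphResolventMean y p G - meanResolvent y n p} ∪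
        {G | ε ≤ -graphResolventMean y p G - -meanResolvent y n p}) := by
        refine measureReal_mono fun G hG => ?_
        rcases le_abs.1 (show ε ≤ |_| from hG) with h | h
        · exact Or.inl h
        · refine Or.inr ?_
          change ε ≤ -graphResolventMean y p G - -meanResolvent y n p
          linarith
    _ ≤ _ := (measureReal_union_le _ _).trans (by linarith)

theorem sq_le_two_mul_exp_add_exp (x : ℝ) : x ^ 2 ≤ 2 * (Real.exp x + Real.exp (-x)) := by
  rcases le_total 0 x with h | h
  · have := Real.quadratic_le_exp_of_nonneg h
    have := Real.exp_pos (-x)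
    nlinarith
  · have := Real.quadratic_le_exp_of_nonneg (neg_nonneg.2 h)
    have := Real.exp_pos x
    nlinarith

/-- Replaces the mean of f² by the square of the mean. The variance is O(1/n), by the exponential
moments at l = ±√n and x² ≤ 2(exp x + exp(-x)). -/
theorem abs_meanResolvent_equation_le {n : ℕ} {p : I} (hnp : 0 < (n : ℝ) * p) {y : ℝ}
    (hy : 0 < y) (ha : 1 / Real.sqrt (n * p) * (2 * (y⁻¹) ^ 2) ≤ 1) :
    |1 - y * meanResolvent y n p - meanResolvent y n p ^ 2|
      ≤ 24 * (1 / Real.sqrt (n * p)) * (y⁻¹) ^ 3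
        + ((y⁻¹) ^ 2 + 4 * Real.exp (4 * (y⁻¹) ^ 4)) * (1 / n) := by
  have hn0 : n ≠ 0 := by rintro rfl; simp at hnp
  have hn : 0 < n := Nat.pos_of_ne_zero hn0
  have hn1 : (1 : ℝ) ≤ n := by exact_mod_cast hn
  have hn' : (0 : ℝ) < n := by exact_mod_cast hn
  have h1 := abs_selfConsistent_le hy hn (scaledSign_false n p) (coinWeight_nonneg p)
    (sum_coinWeight p) (sum_coinWeight_mul_scaledSign n p) (sum_coinWeight_mul_scaledSign_sq hnp)
    (abs_scaledSign_le n p)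
  set f : (VertexPair n → Bool × Bool) → ℝ := resolventMean y (scaledSign n p) with hf
  have hm : productExpectation (coinWeight p) f = meanResolvent y n p := rfl
  have hm2 : |meanResolvent y n p| ≤ y⁻¹ :=
    productExpectation.abs_le (coinWeight_nonneg p) (sum_coinWeight p) fun c => by
      rw [abs_of_nonneg (resolventMean_nonneg hy c)]
      exact resolventMean_le hy c
  have hmgf : ∀ l : ℝ, |l| = Real.sqrt n → productExpectation (coinWeight p)
      (fun c => Real.exp (l * (f c - meanResolvent y n p))) ≤ Real.exp (4 * (y⁻¹) ^ 4) := by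
    intro l hl
    have h2 := productExpectation_exp_resolventMean_le hy hn (scaledSign_false n p)
      (coinWeight_nonneg p) (sum_coinWeight p) (sum_coinWeight_mul_scaledSign_sq hnp)
      (abs_scaledSign_le n p) l (by
        rw [hl]
        have h3 : Real.sqrt n / n ≤ 1 := by
          rw [div_le_one hn', Real.sqrt_le_left hn'.le]
          nlinarith
        calc _ = (Real.sqrt n / n) * (1 / Real.sqrt (n * p) * (2 * (y⁻¹) ^ 2)) := by ring
          _ ≤ 1 * 1 := by gcongr
          _ = 1 := one_mul 1)
    refine h2.trans (le_of_eq ?_)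
    rw [← sq_abs l, hl, Real.sq_sqrt hn'.le]
    congr 1
    field_simp
  have hvar : productExpectation (coinWeight p) (fun c => f c ^ 2) - meanResolvent y n p ^ 2
      = productExpectation (coinWeight p) (fun c => (f c - meanResolvent y n p) ^ 2) := by
    have h4 : (fun c => (f c - meanResolvent y n p) ^ 2) = fun c =>
        f c ^ 2 - 2 * meanResolvent y n p * f c + meanResolvent y n p ^ 2 := by
      funext c; ring
    rw [h4, productExpectation.add, productExpectation.sub, productExpectation.const_mul,
      productExpectation.const (sum_coinWeight p), hm]
    ring
  have hvar0 : 0 ≤ productExpectation (coinWeight p) (fun c => (f c - meanResolvent y n p) ^ 2) :=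
    Finset.sum_nonneg fun c _ => mul_nonneg
      (Finset.prod_nonneg fun _ _ => coinWeight_nonneg p _) (sq_nonneg _)
  have hvar1 : productExpectation (coinWeight p) (fun c => (f c - meanResolvent y n p) ^ 2)
      ≤ 4 * Real.exp (4 * (y⁻¹) ^ 4) * (1 / n) := by
    have h5 : productExpectation (coinWeight p) (fun c => n * (f c - meanResolvent y n p) ^ 2)
        ≤ productExpectation (coinWeight p) (fun c =>
          2 * (Real.exp (Real.sqrt n * (f c - meanResolvent y n p))
            + Real.exp (-Real.sqrt n * (f c - meanResolvent y n p)))) := by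
      refine productExpectation.mono (coinWeight_nonneg p) fun c => ?_
      have h6 := sq_le_two_mul_exp_add_exp (Real.sqrt n * (f c - meanResolvent y n p))
      rwa [mul_pow, Real.sq_sqrt hn'.le, ← neg_mul] at h6
    rw [productExpectation.const_mul, productExpectation.const_mul, productExpectation.add] at h5
    have h7 := hmgf (Real.sqrt n) (abs_of_nonneg (Real.sqrt_nonneg _))
    have h8 := hmgf (-Real.sqrt n) (by rw [abs_neg, abs_of_nonneg (Real.sqrt_nonneg _)])
    rw [mul_one_div, le_div_iff₀ hn']
    linarith
  have herr : |y⁻¹ / n * meanResolvent y n p| ≤ (y⁻¹) ^ 2 * (1 / n) := by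
    have hy' : 0 ≤ y⁻¹ := (inv_pos.2 hy).le
    rw [abs_mul, abs_of_nonneg (by positivity : 0 ≤ y⁻¹ / n)]
    calc _ ≤ y⁻¹ / n * y⁻¹ := by gcongr
      _ = _ := by ring
  rw [hm] at h1
  rw [abs_le] at h1 herr ⊢
  constructor <;> linarith [h1.1, h1.2, herr.1, herr.2]

variable {p : ℕ → I}

theorem tendsto_one_div_sqrt (hp : Tendsto (fun n : ℕ => (p n : ℝ) / (1 / (n : ℝ))) atTop atTop) :
    Tendsto (fun n : ℕ => 1 / Real.sqrt (n * p n)) atTop (𝓝 0) := by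
  have h1 : Tendsto (fun n : ℕ => (n : ℝ) * p n) atTop atTop :=
    hp.congr fun n => by rw [div_div_eq_mul_div, div_one, mul_comm]
  simpa only [one_div, Function.comp_def] using
    tendsto_inv_atTop_zero.comp (Real.tendsto_sqrt_atTop.comp h1)

theorem eventually_mul_pos (hp : Tendsto (fun n : ℕ => (p n : ℝ) / (1 / (n : ℝ))) atTop atTop) :
    ∀ᶠ n : ℕ in atTop, 0 < (n : ℝ) * p n := by
  filter_upwards [hp.eventually_gt_atTop 0] with n hn
  rwa [div_div_eq_mul_div, div_one, mul_comm] at hn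

/-- Stability of the quadratic equation: both the mean g and the root m are nonnegative, so the
defect (m - g)(y + m + g) is at least y|m - g| in absolute value. -/
theorem tendsto_meanResolvent
    (hp : Tendsto (fun n : ℕ => (p n : ℝ) / (1 / (n : ℝ))) atTop atTop) {y : ℝ} (hy : 0 < y) :
    Tendsto (fun n => meanResolvent y n (p n)) atTop (𝓝 ((Real.sqrt (4 + y ^ 2) - y) / 2)) := by
  have ha := tendsto_one_div_sqrt hp
  set m := (Real.sqrt (4 + y ^ 2) - y) / 2 with hm
  have hs : Real.sqrt (4 + y ^ 2) ^ 2 = 4 + y ^ 2 := Real.sq_sqrt (by positivity)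
  have hm1 : 1 - y * m - m ^ 2 = 0 := by
    rw [hm]; linear_combination (-1 / 4 : ℝ) * hs
  have hm0 : 0 ≤ m := by
    have : y ≤ Real.sqrt (4 + y ^ 2) := Real.le_sqrt_of_sq_le (by linarith)
    rw [hm]; linarith
  rw [tendsto_iff_norm_sub_tendsto_zero]
  refine squeeze_zero' (g := fun n : ℕ => y⁻¹ * (24 * (1 / Real.sqrt (n * p n)) * (y⁻¹) ^ 3
        + ((y⁻¹) ^ 2 + 4 * Real.exp (4 * (y⁻¹) ^ 4)) * (1 / n)))
    (Eventually.of_forall fun n => norm_nonneg _) ?_ ?_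
  · have h1 : ∀ᶠ n : ℕ in atTop, 1 / Real.sqrt (n * p n) * (2 * (y⁻¹) ^ 2) < 1 :=
      (by simpa only [zero_mul] using ha.mul_const (2 * (y⁻¹) ^ 2) : Tendsto (fun n : ℕ =>
        1 / Real.sqrt (n * p n) * (2 * (y⁻¹) ^ 2)) atTop (𝓝 0)).eventually_lt_const one_pos
    filter_upwards [h1, eventually_mul_pos hp] with n hn1 hnp
    have h2 := abs_meanResolvent_equation_le hnp hy hn1.le
    set g := meanResolvent y n (p n) with hg
    have hg0 : 0 ≤ g := Finset.sum_nonneg fun c _ => mul_nonneg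
      (Finset.prod_nonneg fun _ _ => coinWeight_nonneg _ _) (resolventMean_nonneg hy c)
    have h3 : 1 - y * g - g ^ 2 = (m - g) * (y + m + g) := by linear_combination hm1
    rw [h3, abs_mul] at h2
    rw [Real.norm_eq_abs, abs_sub_comm, inv_mul_eq_div, le_div_iff₀ hy]
    refine le_trans ?_ h2
    gcongr
    rw [abs_of_nonneg (by positivity)]
    linarith
  · have h4 := ((ha.const_mul 24).mul_const ((y⁻¹) ^ 3)).add
      (tendsto_one_div_atTop_nhds_zero_nat.const_mul ((y⁻¹) ^ 2 + 4 * Real.exp (4 * (y⁻¹) ^ 4)))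
    simpa using h4.const_mul y⁻¹

/-- Deviation probabilities are eventually dominated by a geometric series, so Borel–Cantelli
applies whatever the joint law is. -/
theorem ae_tendsto_graphResolventMean {Ω : Type*} [MeasurableSpace Ω] {P : Measure Ω}
    [IsProbabilityMeasure P]
    (hp : Tendsto (fun n : ℕ => (p n : ℝ) / (1 / (n : ℝ))) atTop atTop)
    {G : (n : ℕ) → Ω → OrientedGraph (Fin n)}
    (hG : ∀ n, HasLaw (G n) (randomModel n (p n)) P) {y : ℝ} (hy : 0 < y) :
    ∀ᵐ ω ∂P, Tendsto (fun n => graphResolventMean y (p n) (G n ω)) atTop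
      (𝓝 ((Real.sqrt (4 + y ^ 2) - y) / 2)) := by
  have hdev : ∀ ε : ℝ, 0 < ε → ∀ᵐ ω ∂P, ∀ᶠ n in atTop,
      |graphResolventMean y (p n) (G n ω) - meanResolvent y n (p n)| < ε := by
    intro ε hε
    set r : ℝ := Real.exp (-(ε ^ 2 * y ^ 4 / 16)) with hr
    have hr1 : r < 1 := by
      rw [hr, Real.exp_lt_one_iff, neg_lt_zero]
      positivity
    have h1 : ∀ᶠ n : ℕ in atTop, 1 / Real.sqrt (n * p n) * (ε * y ^ 2 / 4) < 1 :=
      (by simpa using (tendsto_one_div_sqrt hp).mul_const (ε * y ^ 2 / 4) : Tendsto (fun n : ℕ =>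
        1 / Real.sqrt (n * p n) * (ε * y ^ 2 / 4)) atTop (𝓝 0)).eventually_lt_const one_pos
    set s : ℕ → Set Ω := fun n =>
      {ω | ε ≤ |graphResolventMean y (p n) (G n ω) - meanResolvent y n (p n)|} with hs
    have h2 : ∀ᶠ n in atTop, P.real (s n) ≤ 2 * r ^ n := by
      filter_upwards [h1, eventually_mul_pos hp] with n hn hnp
      rw [hs, (hG n).measureReal_eq
        (p := fun g => ε ≤ |graphResolventMean y (p n) g - meanResolvent y n (p n)|)
        MeasurableSpace.measurableSet_top]
      exact randomModel_real_deviation_le hnp hy hε hn.le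
    have h3 : Summable fun n => P.real (s n) := by
      refine Summable.of_norm_bounded_eventually_nat
        ((summable_geometric_of_lt_one (Real.exp_pos _).le hr1).mul_left 2) ?_
      filter_upwards [h2] with n hn
      rwa [Real.norm_of_nonneg measureReal_nonneg]
    have h4 : ∑' n, P (s n) ≠ ⊤ := by
      have h5 : ∀ n, P (s n) = ENNReal.ofReal (P.real (s n)) := fun n =>
        (ofReal_measureReal (measure_ne_top _ _)).symm
      simp only [h5]
      exact h3.tsum_ofReal_ne_top
    filter_upwards [ae_eventually_notMem h4] with ω hω
    filter_upwards [hω] with n hn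
    exact not_le.1 hn
  -- Countably many tolerances allow a single null set.
  have hall : ∀ᵐ ω ∂P, ∀ k : ℕ, ∀ᶠ n in atTop,
      |graphResolventMean y (p n) (G n ω) - meanResolvent y n (p n)| < 1 / ((k : ℝ) + 1) :=
    ae_all_iff.2 fun k => hdev _ (by positivity)
  filter_upwards [hall] with ω hω
  have h6 : Tendsto (fun n => graphResolventMean y (p n) (G n ω) - meanResolvent y n (p n)) atTop
      (𝓝 0) := by
    rw [Metric.tendsto_nhds]
    intro ε hε
    obtain ⟨k, hk⟩ := exists_nat_one_div_lt hε
    filter_upwards [hω k] with n hn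
    rw [Real.dist_eq, sub_zero]
    exact hn.trans hk
  simpa using h6.add (tendsto_meanResolvent hp hy)

end RandomOrientedGraph

end

/-- Semicircle law for random oriented graphs. `G n` is a random oriented graph `G^σ(n, p n)`;
nothing is assumed about the joint law of the `G n` for different `n`. The condition
`p = ω(1/n)` says that `p n / (1 / n) → ∞`. -/
theorem mainTheorem1 {Ω : Type*} [MeasurableSpace Ω] (P : Measure Ω) [IsProbabilityMeasure P]
    (p : ℕ → unitInterval)
    (hp : Tendsto (fun n : ℕ => (p n : ℝ) / (1 / (n : ℝ))) atTop atTop)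
    (G : (n : ℕ) → Ω → OrientedGraph (Fin n))
    (hG : ∀ n, HasLaw (G n) (OrientedGraph.randomModel n (p n)) P) :
    ∀ᵐ ω ∂P, ConvergesInDistribution
      (fun n => empiricalSpectralDistribution
        (OrientedGraph.scaledMatrix_isHermitian (p n) (G n ω)))
      semicircleDistribution := by
  -- Restricting y to the rationals makes the exceptional set a countable union of null sets.
  have h : ∀ᵐ ω ∂P, ∀ y : {q : ℚ // 0 < q}, Tendsto
      (fun n => graphResolventMean (y.1 : ℝ) (p n) (G n ω)) atTop
      (𝓝 ((Real.sqrt (4 + (y.1 : ℝ) ^ 2) - y.1) / 2)) :=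
    ae_all_iff.2 fun y => ae_tendsto_graphResolventMean hp hG (Rat.cast_pos.2 y.2)
  filter_upwards [h] with ω hω
  refine convergesInDistribution_semicircle _ _
    (fun n => (1 / Real.sqrt (n * p n)) • (G n ω).skewAdjMatrix) (fun n => ?_)
    (fun n => I_smul_scaledMatrix (p n) (G n ω)) fun y hy => hω ⟨y, hy⟩
  rw [Matrix.transpose_smul, skewAdjMatrix_transpose, smul_neg]
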